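/- **Theorem.** Let $M,N\ge 1$, let $\mathscr A$ be a nonempty finite set of $M\times N$ matrices and $\mathscr E$ a nonempty finite set of $N\times M$ matrices, all with non-negative integer entries. In the matrix multiplication game (MMG) on $(\mathscr A,\mathscr E)$, in rounds $i=1,2,\dots$ Adam writes a matrix $A_i\in\mathscr A$ and then Eve writes a matrix $E_i\in\mathscr E$, each choice being made as a function of the finite history of the play. Thus a strategy of Adam is a map $\sigma:(\mathscr A\cdot\mathscr E)^*\to\mathscr A$ and a strategy of Eve is a map $\tau:(\mathscr A\cdot\mathscr E)^*\cdot\mathscr A\to\mathscr E$. A pair $(\sigma,\tau)$ determines a unique play $A_1E_1A_2E_2\cdots$, whose payoff (paid by Adam to Eve) is $$P(\sigma,\tau)=\limsup_{k\to\infty}\Big\|\prod_{i=1}^k A_iE_i\Big\|^{1/k},$$ where $\|\cdot\|$ is the sum of the absolute values of the entries. Eve can ensure payoff $\ge v$ if she has a strategy $\tau$ such that $P(\sigma,\tau)\ge v$ for all strategies $\sigma$ of Adam. The maximal payoff that Eve can ensure is the supremum of all such $v$, that is, $\sup_\tau\inf_\sigma P(\sigma,\tau)$. The following problem is undecidable: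 given $M$, $N$ and (lists of the elements of) $\mathscr A$ and $\mathscr E$ as above, is the maximal payoff that Eve can ensure $<2$? -/

import Mathlib

open scoped ENNReal

namespace MMG

/-- A strategy of Adam: it maps a finite history `A₁E₁⋯AₖEₖ` to Adam's next matrix. -/
abbrev AdamStrategy {m n : ℕ} (𝒜 : Set (Matrix (Fin m) (Fin n) ℝ))
    (ℰ : Set (Matrix (Fin n) (Fin m) ℝ)) : Type :=
  List (𝒜 × ℰ) → 𝒜

/-- A strategy of Eve: it maps a finite history `A₁E₁⋯AₖEₖAₖ₊₁` to Eve's next matrix. -/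
abbrev EveStrategy {m n : ℕ} (𝒜 : Set (Matrix (Fin m) (Fin n) ℝ))
    (ℰ : Set (Matrix (Fin n) (Fin m) ℝ)) : Type :=
  List (𝒜 × ℰ) → 𝒜 → ℰ

/-- The history after `k` rounds, when Adam follows `σ` and Eve follows `τ`. -/
def history {m n : ℕ} {𝒜 : Set (Matrix (Fin m) (Fin n) ℝ)} {ℰ : Set (Matrix (Fin n) (Fin m) ℝ)}
    (σ : AdamStrategy 𝒜 ℰ) (τ : EveStrategy 𝒜 ℰ) : ℕ → List (𝒜 × ℰ)
  | 0 => []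
  | k + 1 => history σ τ k ++
      [(σ (history σ τ k), τ (history σ τ k) (σ (history σ τ k)))]

/-- The unique infinite play compatible with both `σ` and `τ`, as the sequence of its rounds
(numbered from `0`). -/
def play {m n : ℕ} {𝒜 : Set (Matrix (Fin m) (Fin n) ℝ)} {ℰ : Set (Matrix (Fin n) (Fin m) ℝ)}
    (σ : AdamStrategy 𝒜 ℰ) (τ : EveStrategy 𝒜 ℰ) (k : ℕ) : 𝒜 × ℰ :=
  (σ (history σ τ k), τ (history σ τ k) (σ (history σ τ k)))

/-- The product of the matrices written in the first `k` rounds, in the order of play. -/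
def partialProduct {m n : ℕ} {𝒜 : Set (Matrix (Fin m) (Fin n) ℝ)}
    {ℰ : Set (Matrix (Fin n) (Fin m) ℝ)} (π : ℕ → 𝒜 × ℰ) (k : ℕ) : Matrix (Fin m) (Fin m) ℝ :=
  ((List.range k).map fun i => (π i).1.1 * (π i).2.1).prod

/-- The `1`-norm of a matrix: the sum of the absolute values of its entries. -/
def oneNorm {m : ℕ} (B : Matrix (Fin m) (Fin m) ℝ) : ℝ :=
  ∑ i, ∑ j, |B i j|

/-- The payoff of a play: the limit superior of the `k`-th roots of the norms of the partial
products. -/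
noncomputable def payoff {m n : ℕ} {𝒜 : Set (Matrix (Fin m) (Fin n) ℝ)}
    {ℰ : Set (Matrix (Fin n) (Fin m) ℝ)} (π : ℕ → 𝒜 × ℰ) : ℝ≥0∞ :=
  Filter.limsup (fun k : ℕ => ENNReal.ofReal (oneNorm (partialProduct π k) ^ (1 / (k : ℝ)))) Filter.atTop

/-- Eve can ensure payoff at least `v`: some strategy of hers yields a payoff of at least `v`
against every strategy of Adam. -/
def EveEnsures {m n : ℕ} (𝒜 : Set (Matrix (Fin m) (Fin n) ℝ))
    (ℰ : Set (Matrix (Fin n) (Fin m) ℝ)) (v : ℝ≥0∞) : Prop :=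
  ∃ τ : EveStrategy 𝒜 ℰ, ∀ σ : AdamStrategy 𝒜 ℰ, v ≤ payoff (play σ τ)

/-- The maximal payoff (the supremum of the payoffs) that Eve can ensure. -/
noncomputable def eveValue {m n : ℕ} (𝒜 : Set (Matrix (Fin m) (Fin n) ℝ))
    (ℰ : Set (Matrix (Fin n) (Fin m) ℝ)) : ℝ≥0∞ :=
  sSup {v : ℝ≥0∞ | EveEnsures 𝒜 ℰ v}

/-- A matrix multiplication game given by nonempty finite sets of matrices with non-negative
integer entries. -/
structure NatGame where
  /-- The number of rows of Adam's matrices. -/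
  m : ℕ
  /-- The number of columns of Adam's matrices. -/
  n : ℕ
  m_pos : 0 < m
  n_pos : 0 < n
  adam : Finset (Matrix (Fin m) (Fin n) ℕ)
  eve : Finset (Matrix (Fin n) (Fin m) ℕ)
  adam_nonempty : adam.Nonempty
  eve_nonempty : eve.Nonempty

/-- Adam's set, as a set of real matrices. -/
def NatGame.adamSet (G : NatGame) : Set (Matrix (Fin G.m) (Fin G.n) ℝ) :=
  {A | ∃ B ∈ G.adam, A = B.map (fun a : ℕ => (a : ℝ))}

/-- Eve's set, as a set of real matrices. -/
def NatGame.eveSet (G : NatGame) : Set (Matrix (Fin G.n) (Fin G.m) ℝ) :=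
  {E | ∃ B ∈ G.eve, E = B.map (fun a : ℕ => (a : ℝ))}

/-- The maximal payoff that Eve can ensure in the game `G`. -/
noncomputable def NatGame.maxEvePayoff (G : NatGame) : ℝ≥0∞ :=
  eveValue G.adamSet G.eveSet

/-- A matrix written out as the list of its rows. -/
def matrixCode {m n : ℕ} (B : Matrix (Fin m) (Fin n) ℕ) : List (List ℕ) :=
  List.ofFn fun i => List.ofFn fun j => B i j

/-- Inputs of the decision problem: the two dimensions, a list of Adam's matrices and a list of
Eve's matrices, each matrix being a list of rows. -/
abbrev GameCode : Type :=
  ℕ × ℕ × List (List (List ℕ)) × List (List (List ℕ))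

/-- `c` is a description of the game `G`: it lists the matrices in the two sets (in any order,
repetitions being allowed). -/
def IsCodeOf (c : GameCode) (G : NatGame) : Prop :=
  ∃ (As : List (Matrix (Fin G.m) (Fin G.n) ℕ)) (Es : List (Matrix (Fin G.n) (Fin G.m) ℕ)),
    (∀ B, B ∈ As ↔ B ∈ G.adam) ∧ (∀ B, B ∈ Es ↔ B ∈ G.eve) ∧
      c = (G.m, G.n, As.map matrixCode, Es.map matrixCode)

end MMG

/-! An alternating counter system can express conjunctions, disjunctions and least fixed points of
its predicates, hence existential quantification and primitive recursion, hence halting. So it is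
undecidable whether Adam can force such a system, started with a given number in a register, to
halt at a successful comparison of two registers.

The matrix game plays the system on row vectors. The block of the current state carries the
coordinates `1`, the register contents `x` and their complements `2 ^ t - 1 - x`; every round
doubles the scale `2 ^ t`, which leaves room for incrementing a register. Complements make it
possible to compare registers by means of non-negative matrices: after `t` rounds a comparison sends
the encoding to a multiple of a unit vector, the starting point of the next run, and the factor is
at least `2 ^ (t + 1)` if the comparison fails and at most `2 ^ (t + 1) - 2` if it holds. Hence
Eve's payoff is less than `2` exactly if Adam can force a comparison that holds: Eve having finitely
many moves, he can then do so in a bounded number of rounds, which keeps the growth rate away from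
`2`. Every run begins with `n + 1` rounds in a chain of auxiliary coordinates; they make up for the
initial scale `2 ^ (n + 1)`, chosen so that the input `n` fits. A third matrix of Adam sends every
vector to a multiple of the starting point. It serves to bring the all-ones vector, whose image
under a non-negative matrix has the norm of the matrix as its sum, into the simulation, and its
factor is so large that Adam never gains by using it otherwise. -/

namespace MMG

/-! ### Alternating counter systems -/

section CounterSystems

variable {V W Q Q' H H' : Type*}

/-- A value that can be assigned to a register: zero, the content of a register, or its
successor. -/
inductive RegExpr (V : Type*)
  | zero
  | reg (j : V)
  | succ (j : V)

namespace RegExpr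

/-- The value of an expression when the register contents are `x`. -/
def eval : RegExpr V → (V → ℕ) → ℕ
  | zero, _ => 0
  | reg j, x => x j
  | succ j, x => x j + 1

/-- Renaming of the registers of an expression. -/
def map (ι : V → W) : RegExpr V → RegExpr W
  | zero => zero
  | reg j => reg (ι j)
  | succ j => succ (ι j)

theorem map_id (e : RegExpr V) : e.map id = e := by
  cases e <;> rfl

theorem eval_map (ι : V → W) (e : RegExpr V) (x : W → ℕ) : (e.map ι).eval x = e.eval (x ∘ ι) := by
  cases e <;> rfl

theorem eval_le (e : RegExpr V) {x : V → ℕ} {b : ℕ} (hx : ∀ r, x r ≤ b) : e.eval x ≤ b + 1 := by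
  cases e <;> simp only [eval, add_le_add_iff_right, zero_le, hx]
  exact (hx _).trans b.le_succ

end RegExpr

/-- An instruction of an alternating counter system with registers `V`, states `Q` and exits `H`.
The system stops at an exit and at a comparison `x i ≤ x j`. After an assignment, Adam chooses the
first argument of `next`, and Eve, knowing his choice, the second one. -/
inductive Instr (V Q H : Type*)
  | exit (h : H)
  | le (i j : V)
  | assign (i : V) (e : RegExpr V) (next : Bool → Bool → Q)

/-- Renaming of the registers, states and exits of an instruction. -/
def Instr.map (ι : V → W) (φ : Q → Q') (θ : H → H') : Instr V Q H → Instr W Q' H'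
  | exit h => exit (θ h)
  | le i j => le (ι i) (ι j)
  | assign i e next => assign (ι i) (e.map ι) fun a b => φ (next a b)

variable [DecidableEq V] [DecidableEq W]

/-- In the system `S`, from state `q` with register contents `x`, Adam can force the play to halt
within `k` instructions, either at a comparison that holds, or at an exit `h` with `X h` true of
the register contents. -/
def ForcesIn (S : Q → Instr V Q H) (X : H → (V → ℕ) → Prop) : ℕ → Q → (V → ℕ) → Prop
  | 0, _, _ => False
  | k + 1, q, x =>
    match S q with
    | .exit h => X h x
    | .le i j => x i ≤ x j
    | .assign i e next =>
      ∃ a, ∀ b, ForcesIn S X k (next a b) (Function.update x i (e.eval x))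

/-- Adam can force the play of `S` to halt as in `ForcesIn`, in some number of instructions. -/
def Forces (S : Q → Instr V Q H) (X : H → (V → ℕ) → Prop) (q : Q) (x : V → ℕ) : Prop :=
  ∃ k, ForcesIn S X k q x

variable {S : Q → Instr V Q H} {X : H → (V → ℕ) → Prop} {q : Q} {x : V → ℕ}

theorem ForcesIn.succ {k : ℕ} (h : ForcesIn S X k q x) : ForcesIn S X (k + 1) q x := by
  induction k generalizing q x with
  | zero => exact h.elim
  | succ k ih =>
    rw [ForcesIn] at h ⊢
    split <;> simp_all only
    exact h.imp fun a ha b => ih (ha b)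

theorem ForcesIn.mono {k l : ℕ} (hkl : k ≤ l) (h : ForcesIn S X k q x) : ForcesIn S X l q x :=
  Nat.le_induction h (fun _ _ => ForcesIn.succ) l hkl

theorem forcesIn_succ_exit_iff {k : ℕ} {h : H} (hq : S q = .exit h) :
    ForcesIn S X (k + 1) q x ↔ X h x := by
  rw [ForcesIn, hq]

theorem forcesIn_succ_le_iff {k : ℕ} {i j : V} (hq : S q = .le i j) :
    ForcesIn S X (k + 1) q x ↔ x i ≤ x j := by
  rw [ForcesIn, hq]

theorem forcesIn_succ_assign_iff {k : ℕ} {i : V} {e : RegExpr V} {next : Bool → Bool → Q}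
    (hq : S q = .assign i e next) :
    ForcesIn S X (k + 1) q x ↔
      ∃ a, ∀ b, ForcesIn S X k (next a b) (Function.update x i (e.eval x)) := by
  rw [ForcesIn, hq]

theorem forces_iff_exists_succ : Forces S X q x ↔ ∃ k, ForcesIn S X (k + 1) q x :=
  ⟨fun ⟨k, h⟩ => ⟨k, h.succ⟩, fun ⟨k, h⟩ => ⟨k + 1, h⟩⟩

theorem forces_exit_iff {h : H} (hq : S q = .exit h) : Forces S X q x ↔ X h x := by
  simp only [forces_iff_exists_succ, forcesIn_succ_exit_iff hq, exists_const]

theorem forces_le_iff {i j : V} (hq : S q = .le i j) : Forces S X q x ↔ x i ≤ x j := by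
  simp only [forces_iff_exists_succ, forcesIn_succ_le_iff hq, exists_const]

theorem forces_assign_iff {i : V} {e : RegExpr V} {next : Bool → Bool → Q}
    (hq : S q = .assign i e next) :
    Forces S X q x ↔ ∃ a, ∀ b, Forces S X (next a b) (Function.update x i (e.eval x)) := by
  simp only [forces_iff_exists_succ, forcesIn_succ_assign_iff hq]
  constructor
  · rintro ⟨k, a, h⟩
    exact ⟨a, fun b => ⟨k, (h b).succ⟩⟩
  · rintro ⟨a, h⟩
    choose k hk using h
    exact ⟨max (k true) (k false) + 1, a,
      fun b => (hk b).mono (by cases b <;> omega)⟩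

theorem update_map_eval_comp {ι : V → W} (hι : Function.Injective ι) (e : RegExpr V) (i : V)
    (x : W → ℕ) : Function.update x (ι i) ((e.map ι).eval x) ∘ ι =
      Function.update (x ∘ ι) i (e.eval (x ∘ ι)) := by
  rw [Function.update_comp_eq_of_injective x hι, RegExpr.eval_map]

/-- Embedding `S` into `S'` may replace an exit by an entire subsystem of `S'`. -/
theorem forces_embed_iff {S' : Q' → Instr W Q' H'} {X' : H' → (W → ℕ) → Prop} {ι : V → W}
    (hι : Function.Injective ι) {φ : Q → Q'}
    (hexit : ∀ q h, S q = .exit h → ∀ x, Forces S' X' (φ q) x ↔ X h (x ∘ ι))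
    (hle : ∀ q i j, S q = .le i j → S' (φ q) = .le (ι i) (ι j))
    (hassign : ∀ q i e next, S q = .assign i e next →
      S' (φ q) = .assign (ι i) (e.map ι) fun a b => φ (next a b)) (q : Q) (x : W → ℕ) :
    Forces S' X' (φ q) x ↔ Forces S X q (x ∘ ι) := by
  constructor
  · rintro ⟨k, hk⟩
    induction k generalizing q x with
    | zero => exact hk.elim
    | succ k ih =>
      rcases hq : S q with h | ⟨i, j⟩ | ⟨i, e, next⟩
      · exact (forces_exit_iff hq).2 ((hexit q h hq x).1 ⟨_, hk⟩)
      · exact (forces_le_iff hq).2 ((forcesIn_succ_le_iff (hle q i j hq)).1 hk)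
      · obtain ⟨a, ha⟩ := (forcesIn_succ_assign_iff (hassign q i e next hq)).1 hk
        exact (forces_assign_iff hq).2
          ⟨a, fun b => update_map_eval_comp hι e i x ▸ ih _ _ (ha b)⟩
  · rintro ⟨k, hk⟩
    induction k generalizing q x with
    | zero => exact hk.elim
    | succ k ih =>
      rcases hq : S q with h | ⟨i, j⟩ | ⟨i, e, next⟩
      · exact (hexit q h hq x).2 ((forcesIn_succ_exit_iff hq).1 hk)
      · exact (forces_le_iff (hle q i j hq)).2 ((forcesIn_succ_le_iff hq).1 hk)
      · obtain ⟨a, ha⟩ := (forcesIn_succ_assign_iff hq).1 hk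
        exact (forces_assign_iff (hassign q i e next hq)).2
          ⟨a, fun b => ih _ _ ((update_map_eval_comp hι e i x).symm ▸ ha b)⟩

theorem forces_map_iff {S' : Q' → Instr W Q' H'} {X' : H' → (W → ℕ) → Prop} {ι : V → W}
    (hι : Function.Injective ι) {φ : Q → Q'} {θ : H → H'}
    (hS : ∀ q, S' (φ q) = (S q).map ι φ θ) (hX : ∀ h x, X' (θ h) x ↔ X h (x ∘ ι))
    (q : Q) (x : W → ℕ) : Forces S' X' (φ q) x ↔ Forces S X q (x ∘ ι) :=
  forces_embed_iff hι
    (fun q h hq x => (forces_exit_iff (by rw [hS, hq, Instr.map])).trans (hX h x))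
    (fun q i j hq => by rw [hS, hq, Instr.map])
    (fun q i e next hq => by rw [hS, hq, Instr.map]) q x

/-- The exit `none` is replaced by a jump to the state `q₀`. -/
def Instr.loop (q₀ : Q) : Instr ℕ Q (Option H) → Instr ℕ Q H
  | exit none => assign 0 (.reg 0) fun _ _ => q₀
  | exit (some h) => exit h
  | le i j => le i j
  | assign i e next => assign i e next

theorem forces_loop_iff {S : Q → Instr ℕ Q (Option H)} {q₀ : Q} {X : H → (ℕ → ℕ) → Prop} (q : Q)
    (x : ℕ → ℕ) : Forces (fun q => (S q).loop q₀) X q x ↔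
      Forces S (fun o => o.elim (Forces (fun q => (S q).loop q₀) X q₀) X) q x := by
  refine forces_embed_iff (φ := id) Function.injective_id ?_ ?_ ?_ q x
  · rintro q (_ | h) hq x
    · rw [forces_assign_iff (congrArg (Instr.loop q₀) hq), RegExpr.eval, Function.update_eq_self,
        exists_const, forall_const]
      rfl
    · exact forces_exit_iff (congrArg (Instr.loop q₀) hq)
  · exact fun q i j hq => congrArg (Instr.loop q₀) hq
  · exact fun q i e next hq => by rw [RegExpr.map_id]; exact congrArg (Instr.loop q₀) hq

theorem forces_of_forcesIn_loop {S : Q → Instr ℕ Q (Option H)} {q₀ : Q}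
    {X : H → (ℕ → ℕ) → Prop} {L : (ℕ → ℕ) → Prop}
    (hL : ∀ x, Forces S (fun o => o.elim L X) q₀ x → L x) {k : ℕ} {q : Q} {x : ℕ → ℕ}
    (h : ForcesIn (fun q => (S q).loop q₀) X k q x) : Forces S (fun o => o.elim L X) q x := by
  induction k generalizing q x with
  | zero => exact h.elim
  | succ k ih =>
    rcases hq : S q with (_ | o) | ⟨i, j⟩ | ⟨i, e, next⟩ <;>
      have hq' := congrArg (Instr.loop q₀) hq
    · rw [forcesIn_succ_assign_iff hq', RegExpr.eval, Function.update_eq_self, exists_const,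
        forall_const] at h
      exact (forces_exit_iff hq).2 (hL x (ih h))
    · exact (forces_exit_iff hq).2 ((forcesIn_succ_exit_iff (X := X) hq').1 h)
    · exact (forces_le_iff hq).2 ((forcesIn_succ_le_iff hq').1 h)
    · obtain ⟨a, ha⟩ := (forcesIn_succ_assign_iff hq').1 h
      exact (forces_assign_iff hq).2 ⟨a, fun b => ih (ha b)⟩

end CounterSystems

/-! ### Definability by counter systems -/

/-- The operator `F`, which sends a family of predicates on register contents to such a predicate,
is computed by a finite alternating counter system whose exits carry the predicates of the
family. -/
def Definable {H : Type} (F : (H → (ℕ → ℕ) → Prop) → (ℕ → ℕ) → Prop) : Prop :=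
  ∃ (Q : Type) (_ : Finite Q) (S : Q → Instr ℕ Q H) (q₀ : Q), ∀ X x, Forces S X q₀ x ↔ F X x

namespace Definable

variable {H H' : Type} {F G : (H → (ℕ → ℕ) → Prop) → (ℕ → ℕ) → Prop}

theorem congr (hF : Definable F) (h : ∀ X x, F X x ↔ G X x) : Definable G := by
  obtain ⟨Q, hQ, S, q₀, hS⟩ := hF
  exact ⟨Q, hQ, S, q₀, fun X x => (hS X x).trans (h X x)⟩

theorem exit (h : H) : Definable fun X => X h :=
  ⟨Unit, inferInstance, fun _ => .exit h, (), fun _ _ => forces_exit_iff rfl⟩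

theorem le (i j : ℕ) : Definable (H := H) fun _ x => x i ≤ x j :=
  ⟨Unit, inferInstance, fun _ => .le i j, (), fun _ _ => forces_le_iff rfl⟩

theorem mapExits (hF : Definable F) (θ : H → H') : Definable fun X => F (X ∘ θ) := by
  obtain ⟨Q, hQ, S, q₀, hS⟩ := hF
  refine ⟨Q, hQ, fun q => (S q).map id id θ, q₀, fun X x => ?_⟩
  exact (forces_map_iff (φ := id) (θ := θ) Function.injective_id (fun _ => rfl)
    (fun _ _ => Iff.rfl) q₀ x).trans (hS _ x)

theorem assign (hF : Definable F) (i : ℕ) (e : RegExpr ℕ) :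
    Definable fun X x => F X (Function.update x i (e.eval x)) := by
  obtain ⟨Q, _, S, q₀, hS⟩ := hF
  refine ⟨Option Q, inferInstance, fun p => p.elim (.assign i e fun _ _ => some q₀)
    fun q => (S q).map id some id, none, fun X x => ?_⟩
  rw [forces_assign_iff rfl, exists_const, forall_const]
  exact (forces_map_iff (φ := some) (θ := id) Function.injective_id (fun _ => rfl)
    (fun _ _ => Iff.rfl) q₀ _).trans (hS X _)

theorem combine (hF : Definable F) (hG : Definable G) (choice : Bool → Bool → Bool) :
    Definable fun X x => ∃ a, ∀ b, cond (choice a b) (F X x) (G X x) := by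
  obtain ⟨Q₁, _, S₁, q₁, hS₁⟩ := hF
  obtain ⟨Q₂, _, S₂, q₂, hS₂⟩ := hG
  let S : Option (Q₁ ⊕ Q₂) → Instr ℕ (Option (Q₁ ⊕ Q₂)) H
    | none => .assign 0 (.reg 0) fun a b => some (cond (choice a b) (.inl q₁) (.inr q₂))
    | some (.inl q) => (S₁ q).map id (fun q => some (.inl q)) id
    | some (.inr q) => (S₂ q).map id (fun q => some (.inr q)) id
  refine ⟨_, inferInstance, S, none, fun X x => ?_⟩
  have hF (x) : Forces S X (some (.inl q₁)) x ↔ F X x :=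
    (forces_map_iff (φ := some ∘ Sum.inl) (θ := id) Function.injective_id
      (fun _ => rfl) (fun _ _ => Iff.rfl) q₁ x).trans (hS₁ X x)
  have hG (x) : Forces S X (some (.inr q₂)) x ↔ G X x :=
    (forces_map_iff (φ := some ∘ Sum.inr) (θ := id) Function.injective_id
      (fun _ => rfl) (fun _ _ => Iff.rfl) q₂ x).trans (hS₂ X x)
  rw [forces_assign_iff (S := S) rfl, RegExpr.eval, Function.update_eq_self]
  refine exists_congr fun a => forall_congr' fun b => ?_
  cases choice a b
  exacts [hG x, hF x]

theorem and (hF : Definable F) (hG : Definable G) : Definable fun X x => F X x ∧ G X x :=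
  (hF.combine hG fun _ b => b).congr fun X x => by
    simp only [exists_const, Bool.forall_bool, cond_true, cond_false, and_comm]

theorem or (hF : Definable F) (hG : Definable G) : Definable fun X x => F X x ∨ G X x :=
  (hF.combine hG fun a _ => a).congr fun X x => by
    simp only [forall_const, Bool.exists_bool, cond_true, cond_false, or_comm]

theorem lfp {F : (Option H → (ℕ → ℕ) → Prop) → (ℕ → ℕ) → Prop}
    {L : (H → (ℕ → ℕ) → Prop) → (ℕ → ℕ) → Prop} (hF : Definable F)
    (hL : ∀ X, IsLeast {P | F (fun o => o.elim P X) ≤ P} (L X)) : Definable L := by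
  obtain ⟨Q, hQ, S, q₀, hS⟩ := hF
  refine ⟨Q, hQ, fun q => (S q).loop q₀, q₀, fun X x => ⟨fun ⟨k, hk⟩ => ?_, (hL X).2 ?_ x⟩⟩
  · have hprefixed (x) : Forces S (fun o => o.elim (L X) X) q₀ x → L X x :=
      fun h => (hL X).1 x ((hS _ x).1 h)
    exact hprefixed x (forces_of_forcesIn_loop hprefixed hk)
  · exact fun x hx => (forces_loop_iff q₀ x).2 ((hS _ x).2 hx)

theorem ex (hF : Definable F) (i : ℕ) :
    Definable fun X x => ∃ v, F X (Function.update x i v) := by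
  have hsearch : Definable fun (X : H → (ℕ → ℕ) → Prop) x =>
      ∃ v, x i ≤ v ∧ F X (Function.update x i v) := by
    refine ((hF.mapExits some).or ((exit none).assign i (.succ i))).lfp fun X => ⟨?_, ?_⟩
    · rintro x (hx | ⟨v, hv, hx⟩)
      · exact ⟨x i, le_rfl, by rwa [Function.update_eq_self]⟩
      · rw [Function.update_self, RegExpr.eval] at hv
        exact ⟨v, by omega, by rwa [Function.update_idem] at hx⟩
    · rintro P hP x ⟨v, hv, hx⟩
      induction hd : v - x i generalizing x with
      | zero =>
        obtain rfl : v = x i := by omega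
        exact hP x (.inl (by rwa [Function.update_eq_self] at hx))
      | succ d ih =>
        refine hP x (.inr (ih _ ?_ ?_ ?_))
        · rw [Function.update_self, RegExpr.eval]; omega
        · rwa [Function.update_idem]
        · rw [Function.update_self, RegExpr.eval]; omega
  exact (hsearch.assign i .zero).congr fun X x => by
    simp only [RegExpr.eval, Function.update_self, zero_le, true_and, Function.update_idem]

theorem eq (i j : ℕ) : Definable (H := H) fun _ x => x i = x j :=
  ((le i j).and (le j i)).congr fun _ _ => le_antisymm_iff.symm

theorem lift {ρ : (ℕ → ℕ) → Prop} (hρ : Definable (H := Empty) fun _ => ρ) :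
    Definable (H := H) fun _ => ρ :=
  hρ.mapExits Empty.elim

end Definable

/-- The graph of `f` is definable, whichever registers hold the arguments and the value. -/
def DefinableFun {n : ℕ} (f : List.Vector ℕ n → ℕ) : Prop :=
  ∀ (a : Fin n → ℕ) (d : ℕ), Definable (H := Empty) fun _ x => x d = f (.ofFn (x ∘ a))

theorem exists_fresh_register {n : ℕ} (a : Fin n → ℕ) (s : Finset ℕ) :
    ∃ c, c ∉ Set.range a ∧ c ∉ s := by
  obtain ⟨c, hc⟩ := Infinite.exists_notMem_finset (Finset.univ.image a ∪ s)
  simp only [Finset.mem_union, Finset.mem_image, Finset.mem_univ, true_and, not_or] at hc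
  exact ⟨c, hc⟩

namespace DefinableFun

variable {n : ℕ}

theorem zero : DefinableFun (n := 0) fun _ => 0 := fun _ d =>
  ((Definable.le d (d + 1)).assign (d + 1) .zero).congr fun _ x => by
    simp [RegExpr.eval]

theorem succ : DefinableFun (n := 1) fun v => v.head.succ := fun a d => by
  obtain ⟨c, hc⟩ := Infinite.exists_notMem_finset {d}
  exact ((Definable.eq d c).assign c (.succ (a 0))).congr fun _ x => by
    simp [RegExpr.eval, Function.update_of_ne (Ne.symm (Finset.notMem_singleton.1 hc))]

theorem get (i : Fin n) : DefinableFun fun v => v.get i := fun a d =>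
  (Definable.eq d (a i)).congr fun _ _ => by
    simp only [List.Vector.get_ofFn, Function.comp_apply]

theorem comp {m : ℕ} {f : List.Vector ℕ n → ℕ} {g : Fin n → List.Vector ℕ m → ℕ}
    (hf : DefinableFun f) (hg : ∀ i, DefinableFun (g i)) :
    DefinableFun fun v => f (.ofFn fun i => g i v) := by
  intro a d
  -- The arguments of `f` are replaced one at a time; those not in `s` are still in registers.
  suffices h : ∀ (s : Finset (Fin n)) (b : Fin n → ℕ), Definable (H := Empty) fun _ x =>
      x d = f (.ofFn fun i => if i ∈ s then g i (.ofFn (x ∘ a)) else x (b i)) from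
    (h Finset.univ 0).congr fun _ x => by simp only [Finset.mem_univ, if_true]
  intro s
  induction s using Finset.induction_on with
  | empty => exact fun b => (hf b d).congr fun _ x => by simp [Function.comp_def]
  | insert j s hj ih =>
    intro b
    obtain ⟨c, hca, hc⟩ := exists_fresh_register a (insert d (Finset.univ.image b))
    simp only [Finset.mem_insert, Finset.mem_image, Finset.mem_univ, true_and, not_or,
      not_exists] at hc
    refine (((hg j a c).and (ih (Function.update b j c))).ex c).congr fun _ x => ?_
    simp only [Function.update_comp_eq_of_notMem_range _ _ hca, Function.update_self,
      Function.update_of_ne (Ne.symm hc.1), exists_eq_left]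
    refine iff_of_eq (congrArg (fun w => x d = f (.ofFn w)) (funext fun i => ?_))
    rcases eq_or_ne i j with rfl | hij
    · simp [hj]
    · simp [hij, hc.2 i]

/-- The values of the function defined from `f` and `g` by primitive recursion. -/
def precValue (f : List.Vector ℕ n → ℕ) (g : List.Vector ℕ (n + 2) → ℕ) (v : List.Vector ℕ n)
    (m : ℕ) : ℕ :=
  m.rec (f v) fun y IH => g (y ::ᵥ IH ::ᵥ v)

theorem definable_precStep {g : List.Vector ℕ (n + 2) → ℕ} (hg : DefinableFun g)
    {a : Fin n → ℕ} {p r y z : ℕ} (hya : y ∉ Set.range a) (hza : z ∉ Set.range a)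
    (hy : y ≠ p ∧ y ≠ r) (hz : z ≠ p ∧ z ≠ r ∧ z ≠ y) :
    Definable fun (X : Option Empty → (ℕ → ℕ) → Prop) x => ∃ m v,
      x p = m + 1 ∧ x r = g (m ::ᵥ v ::ᵥ .ofFn (x ∘ a)) ∧
        X none (Function.update (Function.update (Function.update (Function.update x y m) z v)
          p m) r v) := by
  have hpred : Definable (H := Option Empty) fun _ x => x p = x y + 1 :=
    (succ ![y] p).lift
  have hstep : Definable (H := Option Empty) fun _ x =>
      x r = g (x y ::ᵥ x z ::ᵥ .ofFn (x ∘ a)) :=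
    (hg (Fin.cons y (Fin.cons z a)) r).lift
  have hcall := ((Definable.exit (none : Option Empty)).assign r (.reg z)).assign p (.reg y)
  refine (((hpred.and (hstep.and hcall)).ex z).ex y).congr fun X x => ?_
  simp only [RegExpr.eval, Function.update_comp_eq_of_notMem_range _ _ hya,
    Function.update_comp_eq_of_notMem_range _ _ hza, Function.update_self,
    Function.update_of_ne hy.1.symm, Function.update_of_ne hy.2.symm,
    Function.update_of_ne hz.1.symm, Function.update_of_ne hz.2.1.symm,
    Function.update_of_ne hz.2.2.symm, Function.update_of_ne hz.1]

theorem definable_eq_precValue {f : List.Vector ℕ n → ℕ} {g : List.Vector ℕ (n + 2) → ℕ}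
    (hf : DefinableFun f) (hg : DefinableFun g) {a : Fin n → ℕ} {p r : ℕ}
    (hp : p ∉ Set.range a) (hr : r ∉ Set.range a) (hpr : p ≠ r) :
    Definable (H := Empty) fun _ x => x r = precValue f g (.ofFn (x ∘ a)) (x p) := by
  obtain ⟨y, hya, hy⟩ := exists_fresh_register a {p, r}
  obtain ⟨z, hza, hz⟩ := exists_fresh_register a {p, r, y}
  simp only [Finset.mem_insert, Finset.mem_singleton, not_or] at hy hz
  have hbase : Definable (H := Option Empty) fun _ x => x p = 0 ∧ x r = f (.ofFn (x ∘ a)) :=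
    (zero ![] p).lift.and (hf a r).lift
  refine (hbase.or (definable_precStep hg hya hza hy hz)).lfp fun X => ⟨?_, ?_⟩
  · rintro x (⟨hxp, hxr⟩ | ⟨m, v, hxp, hxr, hv⟩)
    · rw [hxp, hxr]; rfl
    · simp only [Option.elim, Function.update_comp_eq_of_notMem_range _ _ hr,
        Function.update_comp_eq_of_notMem_range _ _ hp,
        Function.update_comp_eq_of_notMem_range _ _ hza,
        Function.update_comp_eq_of_notMem_range _ _ hya, Function.update_self,
        Function.update_of_ne hpr] at hv
      simp only [hxp, hxr, hv, precValue]
  · intro P hP x hx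
    induction hm : x p generalizing x with
    | zero => exact hP x (.inl ⟨hm, by rw [hx, hm]; rfl⟩)
    | succ m ih =>
      refine hP x (.inr ⟨m, precValue f g (.ofFn (x ∘ a)) m, hm, by rw [hx, hm]; rfl,
        ih _ ?_ ?_⟩)
      · simp only [Function.update_comp_eq_of_notMem_range _ _ hr,
          Function.update_comp_eq_of_notMem_range _ _ hp,
          Function.update_comp_eq_of_notMem_range _ _ hza,
          Function.update_comp_eq_of_notMem_range _ _ hya, Function.update_self,
          Function.update_of_ne hpr]
      · rw [Function.update_of_ne hpr, Function.update_self]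

theorem prec {f : List.Vector ℕ n → ℕ} {g : List.Vector ℕ (n + 2) → ℕ}
    (hf : DefinableFun f) (hg : DefinableFun g) :
    DefinableFun fun v : List.Vector ℕ (n + 1) => precValue f g v.tail v.head := by
  intro a d
  obtain ⟨p, hpa, hp⟩ := exists_fresh_register a {d}
  obtain ⟨r, hra, hr⟩ := exists_fresh_register a {d, p}
  simp only [Finset.mem_insert, Finset.mem_singleton, not_or] at hp hr
  have htail {c : ℕ} (hc : c ∉ Set.range a) : c ∉ Set.range (a ∘ Fin.succ) :=
    fun h => hc (Set.range_comp_subset_range _ _ h)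
  have hvalue := definable_eq_precValue hf hg (htail hpa) (htail hra) (Ne.symm hr.2)
  refine ((hvalue.assign r (.reg d)).assign p (.reg (a 0))).congr fun _ x => ?_
  simp only [RegExpr.eval, Function.update_comp_eq_of_notMem_range _ _ (htail hpa),
    Function.update_comp_eq_of_notMem_range _ _ (htail hra), Function.update_self,
    Function.update_of_ne (Ne.symm hr.2), Function.update_of_ne (Ne.symm hp)]
  rfl

theorem of_primrec' {f : List.Vector ℕ n → ℕ} (hf : Nat.Primrec' f) : DefinableFun f := by
  induction hf with
  | zero => exact zero
  | succ => exact succ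
  | get i => exact get i
  | comp g _ _ hf hg => exact hf.comp hg
  | prec _ _ hf hg => exact hf.prec hg

end DefinableFun

theorem computablePred_comp {α β : Type*} [Primcodable α] [Primcodable β] {p : β → Prop}
    (hp : ComputablePred p) {f : α → β} (hf : Computable f) : ComputablePred fun a => p (f a) :=
  ComputablePred.computable_of_manyOneReducible ⟨f, hf, fun _ => Iff.rfl⟩ hp

open Nat.Partrec (Code) in
theorem exists_primrec₂_halting_iff : ∃ F : ℕ → ℕ → ℕ, Primrec₂ F ∧
    ∀ c : Code, (c.eval 0).Dom ↔ ∃ s, F s (Encodable.encode c) = 0 := by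
  refine ⟨fun s e => 1 - Encodable.encode (Code.evaln s (Denumerable.ofNat Code e) 0), ?_, ?_⟩
  · exact Primrec.nat_sub.comp (.const 1) (Primrec.encode.comp (Code.primrec_evaln.comp
      ((Primrec.fst.pair ((Primrec.ofNat Code).comp Primrec.snd)).pair (.const 0))))
  · intro c
    simp only [Denumerable.ofNat_encode, Part.dom_iff_mem, Code.evaln_complete]
    rw [exists_comm]
    refine exists_congr fun s => ?_
    rcases Code.evaln s c 0 with _ | y <;> simp

theorem exists_undecidable_definable : ∃ ρ : (ℕ → ℕ) → Prop,
    Definable (H := Empty) (fun _ => ρ) ∧ ¬ ComputablePred fun n => ρ (Pi.single 0 n) := by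
  obtain ⟨F, hF, hhalt⟩ := exists_primrec₂_halting_iff
  have hgraph := DefinableFun.of_primrec' (Nat.Primrec'.prim_iff₂.2 hF)
  refine ⟨fun x => ∃ s, F s (x 0) = 0, (((hgraph ![1, 0] 2).assign 2 .zero).ex 1).congr fun _ x =>
    exists_congr fun s => ?_, fun h => ComputablePred.halting_problem 0 ?_⟩
  · simp [RegExpr.eval, eq_comm]
  · exact (computablePred_comp h Computable.encode).of_eq fun c => by
      simp only [hhalt, Pi.single_eq_same]

theorem RegExpr.exists_map_val (e : RegExpr ℕ) :
    ∃ N, ∀ R ≥ N, ∃ e' : RegExpr (Fin (R + 1)), e'.map Fin.val = e := by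
  cases e with
  | zero => exact ⟨0, fun R _ => ⟨.zero, rfl⟩⟩
  | reg j => exact ⟨j, fun R hR => ⟨.reg ⟨j, by omega⟩, rfl⟩⟩
  | succ j => exact ⟨j, fun R hR => ⟨.succ ⟨j, by omega⟩, rfl⟩⟩

theorem Instr.exists_map_val {Q H : Type*} (I : Instr ℕ Q H) :
    ∃ N, ∀ R ≥ N, ∃ I' : Instr (Fin (R + 1)) Q H, I'.map Fin.val id id = I := by
  cases I with
  | exit h => exact ⟨0, fun R _ => ⟨.exit h, rfl⟩⟩
  | le i j => exact ⟨i + j, fun R hR => ⟨.le ⟨i, by omega⟩ ⟨j, by omega⟩, rfl⟩⟩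
  | assign i e next =>
    obtain ⟨N, hN⟩ := e.exists_map_val
    refine ⟨i + N, fun R hR => ?_⟩
    obtain ⟨e', he⟩ := hN R (by omega)
    exact ⟨.assign ⟨i, by omega⟩ e' next, by rw [Instr.map, he]; rfl⟩

theorem exists_undecidable_system : ∃ (R : ℕ) (Q : Type) (_ : Finite Q)
    (S : Q → Instr (Fin (R + 1)) Q Empty) (q₀ : Q),
    ¬ ComputablePred fun n => Forces S Empty.elim q₀ (Pi.single 0 n) := by
  obtain ⟨ρ, ⟨Q, hQ, S, q₀, hS⟩, hρ⟩ := exists_undecidable_definable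
  choose N hN using fun q => (S q).exists_map_val
  obtain ⟨R, hR⟩ := (Set.finite_range N).bddAbove
  choose S' hS' using fun q => hN q R (hR ⟨q, rfl⟩)
  refine ⟨R, Q, hQ, S', q₀, fun h => hρ (h.of_eq fun n => ?_)⟩
  have hsingle : (Pi.single 0 n : ℕ → ℕ) ∘ Fin.val = (Pi.single 0 n : Fin (R + 1) → ℕ) :=
    Function.update_comp_eq_of_injective (0 : ℕ → ℕ) Fin.val_injective (0 : Fin (R + 1)) n
  have hembed := forces_map_iff (X := Empty.elim) (X' := Empty.elim) (φ := id) Fin.val_injective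
    (fun q => (hS' q).symm) (fun h => h.elim) q₀ (Pi.single 0 n)
  rw [hsingle] at hembed
  exact hembed.symm.trans (hS Empty.elim _)

/-! ### Strategies given by invariants -/

open Matrix

section Strategies

variable {m n : ℕ} {𝒜 : Set (Matrix (Fin m) (Fin n) ℝ)} {ℰ : Set (Matrix (Fin n) (Fin m) ℝ)}

theorem history_eq_map (σ : AdamStrategy 𝒜 ℰ) (τ : EveStrategy 𝒜 ℰ) (k : ℕ) :
    history σ τ k = (List.range k).map (play σ τ) := by
  induction k with
  | zero => rfl
  | succ k ih => rw [List.range_succ, List.map_append, ← ih]; rfl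

theorem length_history (σ : AdamStrategy 𝒜 ℰ) (τ : EveStrategy 𝒜 ℰ) (k : ℕ) :
    (history σ τ k).length = k := by
  rw [history_eq_map, List.length_map, List.length_range]

theorem partialProduct_succ (π : ℕ → 𝒜 × ℰ) (k : ℕ) :
    partialProduct π (k + 1) = partialProduct π k * ((π k).1.1 * (π k).2.1) := by
  simp [partialProduct, List.range_succ]

/-- The row vector obtained from `u` after a finite history. -/
noncomputable def rowAfter (u : Fin m → ℝ) (h : List (𝒜 × ℰ)) : Fin m → ℝ :=
  u ᵥ* (h.map fun p => p.1.1 * p.2.1).prod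

theorem rowAfter_history (u : Fin m → ℝ) (σ : AdamStrategy 𝒜 ℰ) (τ : EveStrategy 𝒜 ℰ) (k : ℕ) :
    rowAfter u (history σ τ k) = u ᵥ* partialProduct (play σ τ) k := by
  rw [rowAfter, history_eq_map, List.map_map]
  rfl

theorem exists_eveStrategy {K : ℕ → Set (Fin m → ℝ)} {u : Fin m → ℝ} (hu : u ∈ K 0)
    (hstep : ∀ k, ∀ y ∈ K k, ∀ A ∈ 𝒜, ∃ E ∈ ℰ, y ᵥ* A ᵥ* E ∈ K (k + 1)) :
    ∃ τ : EveStrategy 𝒜 ℰ, ∀ (σ : AdamStrategy 𝒜 ℰ) (k : ℕ),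
      u ᵥ* partialProduct (play σ τ) k ∈ K k := by
  have hreply (h : List (𝒜 × ℰ)) (A : 𝒜) : ∃ E : ℰ, rowAfter u h ∈ K h.length →
      rowAfter u h ᵥ* A.1 ᵥ* E.1 ∈ K (h.length + 1) := by
    by_cases hK : rowAfter u h ∈ K h.length
    · obtain ⟨E, hE, hyE⟩ := hstep _ _ hK A.1 A.2
      exact ⟨⟨E, hE⟩, fun _ => hyE⟩
    · obtain ⟨E, hE, -⟩ := hstep 0 u hu A.1 A.2
      exact ⟨⟨E, hE⟩, fun h => absurd h hK⟩
  choose τ hτ using hreply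
  refine ⟨τ, fun σ k => ?_⟩
  induction k with
  | zero => simpa [partialProduct] using hu
  | succ k ih =>
    have hround := hτ (history σ τ k) (σ (history σ τ k))
    rw [rowAfter_history, length_history, vecMul_vecMul, vecMul_vecMul] at hround
    rw [partialProduct_succ]
    exact hround ih

theorem exists_adamStrategy {K : ℕ → Set (Fin m → ℝ)} {u : Fin m → ℝ} (hu : u ∈ K 0)
    (hstep : ∀ k, ∀ y ∈ K k, ∃ A ∈ 𝒜, ∀ E ∈ ℰ, y ᵥ* A ᵥ* E ∈ K (k + 1)) :
    ∃ σ : AdamStrategy 𝒜 ℰ, ∀ (τ : EveStrategy 𝒜 ℰ) (k : ℕ),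
      u ᵥ* partialProduct (play σ τ) k ∈ K k := by
  have hmove (h : List (𝒜 × ℰ)) : ∃ A : 𝒜, rowAfter u h ∈ K h.length →
      ∀ E ∈ ℰ, rowAfter u h ᵥ* A.1 ᵥ* E ∈ K (h.length + 1) := by
    by_cases hK : rowAfter u h ∈ K h.length
    · obtain ⟨A, hA, hyA⟩ := hstep _ _ hK
      exact ⟨⟨A, hA⟩, fun _ => hyA⟩
    · obtain ⟨A, hA, -⟩ := hstep 0 u hu
      exact ⟨⟨A, hA⟩, fun h => absurd h hK⟩
  choose σ hσ using hmove
  refine ⟨σ, fun τ k => ?_⟩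
  induction k with
  | zero => simpa [partialProduct] using hu
  | succ k ih =>
    have hround := hσ (history σ τ k)
    rw [rowAfter_history, length_history] at hround
    have hreply := hround ih _ (τ (history σ τ k) (σ (history σ τ k))).2
    rw [vecMul_vecMul, vecMul_vecMul] at hreply
    rwa [partialProduct_succ]

theorem oneNorm_nonneg (B : Matrix (Fin m) (Fin m) ℝ) : 0 ≤ oneNorm B :=
  Finset.sum_nonneg fun _ _ => Finset.sum_nonneg fun _ _ => abs_nonneg _

theorem tendsto_root_geometric {C r : ℝ} (hC : 0 < C) (hr : 0 < r) :
    Filter.Tendsto (fun k : ℕ => ENNReal.ofReal ((C * r ^ k) ^ (1 / (k : ℝ)))) Filter.atTop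
      (nhds (ENNReal.ofReal r)) := by
  refine ENNReal.tendsto_ofReal ?_
  have hlim : Filter.Tendsto (fun k : ℕ => C ^ (1 / (k : ℝ)) * r) Filter.atTop
      (nhds (C ^ (0 : ℝ) * r)) :=
    (((Real.continuousAt_const_rpow hC.ne').tendsto.comp
      tendsto_one_div_atTop_nhds_zero_nat)).mul_const r
  rw [Real.rpow_zero, one_mul] at hlim
  refine hlim.congr' ?_
  filter_upwards [Filter.eventually_ne_atTop 0] with k hk
  rw [Real.mul_rpow hC.le (by positivity), one_div, Real.pow_rpow_inv_natCast hr.le hk]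

theorem le_payoff {π : ℕ → 𝒜 × ℰ} {C r : ℝ} (hC : 0 < C) (hr : 0 < r)
    (h : ∀ k, C * r ^ k ≤ oneNorm (partialProduct π k)) : ENNReal.ofReal r ≤ payoff π := by
  rw [← (tendsto_root_geometric hC hr).limsup_eq]
  refine Filter.limsup_le_limsup (Filter.Eventually.of_forall fun k => ?_)
  exact ENNReal.ofReal_le_ofReal (Real.rpow_le_rpow (by positivity) (h k) (by positivity))

theorem payoff_le {π : ℕ → 𝒜 × ℰ} {C r : ℝ} (hC : 0 < C) (hr : 0 < r)
    (h : ∀ k, oneNorm (partialProduct π k) ≤ C * r ^ k) : payoff π ≤ ENNReal.ofReal r := by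
  rw [← (tendsto_root_geometric hC hr).limsup_eq]
  refine Filter.limsup_le_limsup (Filter.Eventually.of_forall fun k => ?_)
  exact ENNReal.ofReal_le_ofReal (Real.rpow_le_rpow (oneNorm_nonneg _) (h k) (by positivity))

theorem sum_vecMul_single_le_oneNorm (s : Fin m) (B : Matrix (Fin m) (Fin m) ℝ) :
    ∑ j, (Pi.single s 1 ᵥ* B) j ≤ oneNorm B := by
  rw [single_one_vecMul]
  refine (Finset.sum_le_sum fun j _ => le_abs_self _).trans ?_
  exact Finset.single_le_sum (f := fun i => ∑ j, |B i j|)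
    (fun i _ => Finset.sum_nonneg fun _ _ => abs_nonneg _) (Finset.mem_univ s)

theorem oneNorm_eq_sum_vecMul_one {B : Matrix (Fin m) (Fin m) ℝ} (hB : ∀ i j, 0 ≤ B i j) :
    oneNorm B = ∑ j, (1 ᵥ* B) j := by
  simp only [oneNorm, vecMul, dotProduct, Pi.one_apply, one_mul]
  rw [Finset.sum_comm]
  exact Finset.sum_congr rfl fun j _ => Finset.sum_congr rfl fun i _ => abs_of_nonneg (hB i j)

theorem partialProduct_nonneg (h𝒜 : ∀ A ∈ 𝒜, ∀ i j, 0 ≤ A i j) (hℰ : ∀ E ∈ ℰ, ∀ i j, 0 ≤ E i j)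
    (π : ℕ → 𝒜 × ℰ) (k : ℕ) (i j : Fin m) : 0 ≤ partialProduct π k i j := by
  induction k generalizing i j with
  | zero =>
    simp only [partialProduct, List.range_zero, List.map_nil, List.prod_nil, one_apply]
    split_ifs <;> norm_num
  | succ k ih =>
    rw [partialProduct_succ, mul_apply]
    refine Finset.sum_nonneg fun l _ => mul_nonneg (ih i l) ?_
    rw [mul_apply]
    exact Finset.sum_nonneg fun s _ => mul_nonneg (h𝒜 _ (π k).1.2 _ _) (hℰ _ (π k).2.2 _ _)

theorem inv_pow_succ_smul_vecMul (r : ℝ) (k : ℕ) (y : Fin m → ℝ) (A : Matrix (Fin m) (Fin n) ℝ)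
    (E : Matrix (Fin n) (Fin m) ℝ) :
    (r ^ (k + 1))⁻¹ • (y ᵥ* A ᵥ* E) = r⁻¹ • (((r ^ k)⁻¹ • y) ᵥ* A ᵥ* E) := by
  rw [smul_vecMul, smul_vecMul, smul_smul, pow_succ, _root_.mul_inv_rev]

theorem eveEnsures_of_invariant {K : Set (Fin m → ℝ)} {s : Fin m} {r ε : ℝ} (hr : 0 < r)
    (hε : 0 < ε) (hs : Pi.single s 1 ∈ K)
    (hstep : ∀ y ∈ K, ∀ A ∈ 𝒜, ∃ E ∈ ℰ, r⁻¹ • (y ᵥ* A ᵥ* E) ∈ K)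
    (hsum : ∀ y ∈ K, ε ≤ ∑ j, y j) : EveEnsures 𝒜 ℰ (ENNReal.ofReal r) := by
  obtain ⟨τ, hτ⟩ := exists_eveStrategy (𝒜 := 𝒜) (ℰ := ℰ) (K := fun k => {y | (r ^ k)⁻¹ • y ∈ K})
    (u := Pi.single s 1) (by simpa using hs) fun k y hy A hA => by
      simpa only [Set.mem_ofPred_eq, inv_pow_succ_smul_vecMul] using hstep _ hy A hA
  refine ⟨τ, fun σ => le_payoff hε hr fun k => ?_⟩
  have hk := hsum _ (hτ σ k)
  simp only [Pi.smul_apply, smul_eq_mul, ← Finset.mul_sum] at hk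
  rw [le_inv_mul_iff₀ (pow_pos hr k), mul_comm] at hk
  exact hk.trans (sum_vecMul_single_le_oneNorm s _)

theorem eveValue_le_of_invariant (h𝒜 : ∀ A ∈ 𝒜, ∀ i j, 0 ≤ A i j)
    (hℰ : ∀ E ∈ ℰ, ∀ i j, 0 ≤ E i j) {K : Set (Fin m → ℝ)} {r C : ℝ} (hr : 0 < r) (hC : 0 < C)
    (hone : 1 ∈ K) (hstep : ∀ y ∈ K, ∃ A ∈ 𝒜, ∀ E ∈ ℰ, r⁻¹ • (y ᵥ* A ᵥ* E) ∈ K)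
    (hsum : ∀ y ∈ K, ∑ j, y j ≤ C) : eveValue 𝒜 ℰ ≤ ENNReal.ofReal r := by
  obtain ⟨σ, hσ⟩ := exists_adamStrategy (𝒜 := 𝒜) (ℰ := ℰ) (K := fun k => {y | (r ^ k)⁻¹ • y ∈ K})
    (u := 1) (by simpa using hone) fun k y hy => by
      simpa only [Set.mem_ofPred_eq, inv_pow_succ_smul_vecMul] using hstep _ hy
  refine sSup_le fun v ⟨τ, hτ⟩ => (hτ σ).trans (payoff_le hC hr fun k => ?_)
  have hk := hsum _ (hσ τ k)
  simp only [Pi.smul_apply, smul_eq_mul, ← Finset.mul_sum] at hk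
  rw [inv_mul_le_iff₀ (pow_pos hr k), mul_comm] at hk
  rwa [oneNorm_eq_sum_vecMul_one (partialProduct_nonneg h𝒜 hℰ _ k)]

end Strategies

/-! ### The game of a closed system -/

section Encoding

variable {V : Type*}

/-- The coordinates of the row vector that encodes register contents: `none` holds the constant
`1`, `some (r, false)` the content of the register `r` and `some (r, true)` its complement. -/
abbrev Coord (V : Type*) := Option (V × Bool)

/-- The row vector of the register contents `x` after `t` rounds. The complement of a content is
relative to `2 ^ t - 1`; the subtraction is only meaningful as long as `x r < 2 ^ t`. -/
def encode (x : V → ℕ) (t : ℕ) : Coord V → ℕ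
  | none => 1
  | some (r, false) => x r
  | some (r, true) => 2 ^ t - 1 - x r

theorem sum_encode [Fintype V] {x : V → ℕ} {t : ℕ} (hx : ∀ r, x r < 2 ^ t) :
    ∑ κ, encode x t κ = 1 + Fintype.card V * (2 ^ t - 1) := by
  have hpair (r : V) : 2 ^ t - 1 - x r + x r = 2 ^ t - 1 := by have := hx r; omega
  simp [Fintype.sum_option, Fintype.sum_prod_type, encode, hpair]

theorem two_pow_le_add_complement_iff {x : V → ℕ} {t : ℕ} {i j : V} (hj : x j < 2 ^ t) :
    2 ^ t ≤ x i + (2 ^ t - 1 - x j) ↔ ¬ x i ≤ x j := by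
  omega

variable [DecidableEq V]

namespace RegExpr

/-- The linear form on `Coord V` whose value is the value of the expression. -/
def content : RegExpr V → Coord V → ℕ
  | zero => 0
  | reg j => Pi.single (some (j, false)) 1
  | succ j => Pi.single (some (j, false)) 1 + Pi.single none 1

/-- The linear form on `Coord V` that, on an encoding for `t`, gives the complement of the value of
the expression for `t + 1`. The register `r` serves to produce the complement of zero. -/
def complement (r : V) : RegExpr V → Coord V → ℕ
  | zero => Pi.single (some (r, true)) 2 + Pi.single (some (r, false)) 2 + Pi.single none 1
  | reg j => Pi.single (some (j, true)) 2 + Pi.single (some (j, false)) 1 + Pi.single none 1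
  | succ j => Pi.single (some (j, true)) 2 + Pi.single (some (j, false)) 1

variable [Fintype V]

theorem encode_dotProduct_content (e : RegExpr V) (x : V → ℕ) (t : ℕ) :
    encode x t ⬝ᵥ e.content = e.eval x := by
  cases e <;> simp [content, eval, encode]

theorem encode_dotProduct_complement (e : RegExpr V) {x : V → ℕ} {t : ℕ} (hx : ∀ r, x r < 2 ^ t)
    (r : V) : encode x t ⬝ᵥ e.complement r = 2 ^ (t + 1) - 1 - e.eval x := by
  rcases e with _ | j | j <;>
    simp only [complement, eval, dotProduct_add, dotProduct_single, encode]
  · have := hx r; omega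
  · have := hx j; omega
  · have := hx j; omega

end RegExpr

/-- The matrix of the parallel assignment of `σ r` to every register `r`. -/
def stepMatrix (σ : V → RegExpr V) : Matrix (Coord V) (Coord V) ℕ :=
  of fun κ κ' => match κ' with
    | none => Pi.single (M := fun _ => ℕ) none 1 κ
    | some (r, false) => (σ r).content κ
    | some (r, true) => (σ r).complement r κ

theorem encode_vecMul_stepMatrix [Fintype V] (σ : V → RegExpr V) {x : V → ℕ} {t : ℕ}
    (hx : ∀ r, x r < 2 ^ t) :
    encode x t ᵥ* stepMatrix σ = encode (fun r => (σ r).eval x) (t + 1) := by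
  funext κ
  rcases κ with _ | ⟨r, _ | _⟩
  · exact (dotProduct_single _ _ _).trans (mul_one _)
  · exact (σ r).encode_dotProduct_content x t
  · exact (σ r).encode_dotProduct_complement hx r

theorem eval_update_reg (i : V) (e : RegExpr V) (x : V → ℕ) :
    (fun r => (Function.update RegExpr.reg i e r).eval x) = Function.update x i (e.eval x) := by
  funext r
  rcases eq_or_ne r i with rfl | hr
  · simp only [Function.update_self]
  · simp only [Function.update_of_ne hr, RegExpr.eval]

theorem update_eval_lt {x : V → ℕ} {t : ℕ} (hx : ∀ r, x r < 2 ^ t) (i : V) (e : RegExpr V) (r : V) :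
    Function.update x i (e.eval x) r < 2 ^ (t + 1) := by
  have hle := e.eval_le fun r => Nat.le_sub_one_of_lt (hx r)
  have hr := hx r
  rw [pow_succ]
  rcases eq_or_ne r i with rfl | hri
  · rw [Function.update_self]; omega
  · rw [Function.update_of_ne hri]; omega

end Encoding

section Blocks

variable {σ κ κ' ι : Type*} [DecidableEq σ]

/-- The row vector on `σ × κ` with `v` in block `s` and zero elsewhere. -/
def blockVec (s : σ) (v : κ → ℕ) : σ × κ → ℕ := fun p => if p.1 = s then v p.2 else 0

/-- The matrix with `N` in the column block `s` and zero elsewhere. -/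
def blockMatrix (s : σ) (N : Matrix κ κ' ℕ) : Matrix κ (σ × κ') ℕ := of fun k => blockVec s (N k)

theorem sum_blockVec [Fintype σ] [Fintype κ] (s : σ) (v : κ → ℕ) :
    ∑ p, blockVec s v p = ∑ k, v k := by
  simp [blockVec, Fintype.sum_prod_type]

theorem blockVec_vecMul [Fintype σ] [Fintype κ] (s : σ) (v : κ → ℕ) (N : σ → Matrix κ ι ℕ) :
    blockVec s v ᵥ* of (fun p : σ × κ => N p.1 p.2) = v ᵥ* N s := by
  funext j
  simp [vecMul, dotProduct, blockVec, Fintype.sum_prod_type]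

theorem vecMul_blockMatrix [Fintype κ] (v : κ → ℕ) (s : σ) (N : Matrix κ κ' ℕ) :
    v ᵥ* blockMatrix s N = blockVec s (v ᵥ* N) := by
  funext ⟨t, k⟩
  by_cases h : t = s <;> simp [vecMul, dotProduct, blockMatrix, blockVec, h]

end Blocks

section Chain

variable {α β : Type*} [Fintype α] [Fintype β] {n : ℕ}

/-- The numbering of the index set that consists of `α` and a chain of `n + 1` further indices. -/
noncomputable def chainEquiv (α : Type*) [Fintype α] (n : ℕ) :
    α ⊕ Fin (n + 1) ≃ Fin (Fintype.card α + (n + 1)) :=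
  ((Fintype.equivFin α).sumCongr (.refl _)).trans finSumFinEquiv

/-- The row vector with entries `u` on `α` and `c` on the chain. -/
noncomputable def rowVec (u : α → ℕ) (c : Fin (n + 1) → ℕ) :
    Fin (Fintype.card α + (n + 1)) → ℕ :=
  Sum.elim u c ∘ (chainEquiv α n).symm

/-- The matrix with the blocks `A`, `B`, `C`, `D`. The indices of the chain enter as natural
numbers, so that the blocks make sense for every length of the chain. -/
noncomputable def chainMatrix (n : ℕ) (A : Matrix α β ℕ) (B : α → ℕ → ℕ) (C : ℕ → β → ℕ)
    (D : ℕ → ℕ → ℕ) :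
    Matrix (Fin (Fintype.card α + (n + 1))) (Fin (Fintype.card β + (n + 1))) ℕ :=
  reindex (chainEquiv α n) (chainEquiv β n)
    (fromBlocks A (of fun a j => B a j) (of fun i b => C i b) (of fun i j => D i j))

theorem rowVec_vecMul_chainMatrix (u : α → ℕ) (c : Fin (n + 1) → ℕ) (A : Matrix α β ℕ)
    (B : α → ℕ → ℕ) (C : ℕ → β → ℕ) (D : ℕ → ℕ → ℕ) :
    rowVec u c ᵥ* chainMatrix n A B C D =
      rowVec (u ᵥ* A + c ᵥ* of fun i b => C i b)
        ((u ᵥ* of fun a (j : Fin (n + 1)) => B a j) +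
          c ᵥ* of fun i (j : Fin (n + 1)) => D i j) := by
  rw [rowVec, chainMatrix, reindex_apply, submatrix_vecMul_equiv, Function.comp_assoc,
    Equiv.symm_symm, Equiv.symm_comp_self, Function.comp_id, vecMul_fromBlocks]
  simp only [Sum.elim_comp_inl, Sum.elim_comp_inr]
  rfl

theorem exists_eq_rowVec (w : Fin (Fintype.card α + (n + 1)) → ℕ) : ∃ u c, w = rowVec u c :=
  ⟨fun a => w (chainEquiv α n (.inl a)), fun i => w (chainEquiv α n (.inr i)), by
    funext j
    obtain ⟨i | i, rfl⟩ := (chainEquiv α n).surjective j <;> simp [rowVec]⟩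

theorem smul_rowVec (g : ℕ) (u : α → ℕ) (c : Fin (n + 1) → ℕ) :
    g • rowVec u c = rowVec (g • u) (g • c) := by
  funext j
  obtain ⟨i | i, rfl⟩ := (chainEquiv α n).surjective j <;> simp [rowVec]

theorem sum_rowVec (u : α → ℕ) (c : Fin (n + 1) → ℕ) :
    ∑ j, rowVec u c j = ∑ a, u a + ∑ i, c i := by
  rw [← Fintype.sum_sumElim]
  exact (chainEquiv α n).symm.sum_comp _

theorem vecMul_of_single (u : α → ℕ) (w : α → ℕ) (i : Fin (n + 1)) :
    (u ᵥ* of fun a (j : Fin (n + 1)) => (Pi.single i.val (w a) : ℕ → ℕ) j) =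
      Pi.single i (u ⬝ᵥ w) := by
  funext j
  rcases eq_or_ne j i with rfl | hj
  · simp [vecMul]
  · simp [vecMul, hj, Fin.val_ne_of_ne hj, dotProduct]

end Chain

section Positions

variable {V Q : Type*} {n : ℕ}

/-- What the row vector of the game describes: the `i`-th index of the start-up chain, or a
configuration of the system, reached after `t` rounds. -/
inductive Position (V Q : Type*) (n : ℕ)
  | chain (i : Fin (n + 1))
  | config (q : Q) (x : V → ℕ) (t : ℕ)

namespace Position

/-- The number of rounds since the beginning of the chain. -/
def age : Position V Q n → ℕ
  | chain i => i
  | config _ _ t => t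

/-- The complements in the row vector of the position are meaningful. -/
def Valid : Position V Q n → Prop
  | chain _ => True
  | config _ x t => ∀ r, x r < 2 ^ t

variable [DecidableEq V]

/-- The factor by which the row vector is multiplied in the next round. -/
def gain (S : Q → Instr V Q Empty) : Position V Q n → ℕ
  | chain _ => 1
  | config q x t =>
    match S q with
    | .le i j => 2 * (x i + (2 ^ t - 1 - x j))
    | _ => 1

/-- The position after a round in which the choices are `a` and `b`. -/
def next (S : Q → Instr V Q Empty) (q₀ : Q) (x₀ : V → ℕ) (a b : Bool) :
    Position V Q n → Position V Q n
  | chain i => if h : i.val < n then chain ⟨i + 1, by omega⟩ else config q₀ x₀ (n + 1)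
  | config q x t =>
    match S q with
    | .exit h => h.elim
    | .le _ _ => chain 0
    | .assign i e next => config (next a b) (Function.update x i (e.eval x)) (t + 1)

variable {S : Q → Instr V Q Empty} {q₀ : Q} {x₀ : V → ℕ} {p : Position V Q n}

theorem age_next_chain (i : Fin (n + 1)) (a b : Bool) :
    ((chain i).next S q₀ x₀ a b).age = i + 1 := by
  rw [next]
  split_ifs
  · rfl
  · simp only [age]; omega

theorem Valid.next (hp : p.Valid) (hx₀ : ∀ r, x₀ r < 2 ^ (n + 1)) (a b : Bool) :
    (p.next S q₀ x₀ a b).Valid := by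
  rcases p with i | ⟨q, x, t⟩
  · rw [Position.next]
    split_ifs
    · trivial
    · exact hx₀
  · rw [Position.next]
    rcases S q with h | _ | ⟨i, e, _⟩
    · exact h.elim
    · trivial
    · exact update_eval_lt hp i e

/-- At the position, Adam cannot force a comparison that holds before the next start of the
chain. -/
def Safe (S : Q → Instr V Q Empty) : Position V Q n → Prop
  | chain _ => True
  | config q x _ => ¬ Forces S Empty.elim q x

theorem exists_safe_next (hF : ¬ Forces S Empty.elim q₀ x₀) (hp : p.Valid) (hs : p.Safe S)
    (a : Bool) : ∃ b, (p.next S q₀ x₀ a b).Safe S ∧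
      2 * 2 ^ p.age ≤ p.gain S * 2 ^ (p.next S q₀ x₀ a b).age := by
  rcases p with i | ⟨q, x, t⟩
  · refine ⟨true, ?_, ?_⟩
    · rw [next]
      split_ifs
      · trivial
      · exact hF
    · rw [age_next_chain, gain, age, one_mul, pow_succ']
  · simp only [next, gain, age]
    rcases hq : S q with h | ⟨i, j⟩ | ⟨i, e, next⟩
    · exact h.elim
    · have hij := (two_pow_le_add_complement_iff (i := i) (hp j)).2 (mt (forces_le_iff hq).2 hs)
      exact ⟨true, trivial, by simpa using hij⟩
    · have hs := mt (forces_assign_iff hq).2 hs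
      push Not at hs
      obtain ⟨b, hb⟩ := hs a
      exact ⟨b, hb, by rw [one_mul, pow_succ']⟩

/-- Adam can force a comparison that holds, at most `T` rounds after the start of the chain. -/
def WonBy (S : Q → Instr V Q Empty) (T : ℕ) : Position V Q n → Prop
  | chain _ => True
  | config q x t => ∃ h, ForcesIn S Empty.elim h q x ∧ h + t ≤ T

theorem exists_wonBy_next {T h₀ : ℕ} {r : ℝ} (hF : ForcesIn S Empty.elim h₀ q₀ x₀)
    (hT : h₀ + (n + 1) ≤ T) (hr : ∀ t ≤ T, 2 * (2 ^ t - 1) ≤ r ^ (t + 1)) (hp : p.Valid)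
    (hw : p.WonBy S T) : ∃ a, ∀ b, (p.next S q₀ x₀ a b).WonBy S T ∧
      p.gain S * r ^ (p.next S q₀ x₀ a b).age ≤ r ^ (p.age + 1) := by
  rcases p with i | ⟨q, x, t⟩
  · refine ⟨true, fun b => ⟨?_, ?_⟩⟩
    · rw [next]
      split_ifs
      · trivial
      · exact ⟨h₀, hF, hT⟩
    · rw [age_next_chain, gain, age, Nat.cast_one, one_mul]
  · obtain ⟨_ | h, hh, hle⟩ := hw
    · exact hh.elim
    simp only [next, gain, age]
    rcases hq : S q with h | ⟨i, j⟩ | ⟨i, e, next⟩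
    · exact h.elim
    · have hij := (forcesIn_succ_le_iff hq).1 hh
      have hj := hp j
      refine ⟨true, fun b => ⟨trivial, le_trans ?_ (hr t (by omega))⟩⟩
      have hgain : x i + (2 ^ t - 1 - x j) + 1 ≤ 2 ^ t := by omega
      have hgain_real : (x i + (2 ^ t - 1 - x j : ℕ) + 1 : ℝ) ≤ 2 ^ t := by exact_mod_cast hgain
      simp only [Nat.cast_mul, Nat.cast_add, Nat.cast_ofNat, Fin.val_zero, pow_zero, mul_one]
      linarith
    · obtain ⟨a, ha⟩ := (forcesIn_succ_assign_iff hq).1 hh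
      exact ⟨a, fun b => ⟨⟨h, ha b, by omega⟩, by rw [Nat.cast_one, one_mul]⟩⟩

theorem WonBy.age_le {T : ℕ} (hw : p.WonBy S T) (hT : n ≤ T) : p.age ≤ T := by
  rcases p with i | ⟨q, x, t⟩
  · exact (Nat.le_of_lt_succ i.isLt).trans hT
  · obtain ⟨h, -, hle⟩ := hw
    exact (Nat.le_add_left t h).trans hle

end Position

end Positions

section PositionVectors

variable {V Q : Type*} [Fintype V] [Fintype Q] [DecidableEq Q] {n : ℕ} {p : Position V Q n}

namespace Position

/-- The row vector that describes the position. -/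
noncomputable def vec : Position V Q n → Fin (Fintype.card (Q × Coord V) + (n + 1)) → ℕ
  | chain i => rowVec 0 (Pi.single i 1)
  | config q x t => rowVec (blockVec q (encode x t)) 0

theorem sum_vec_chain (i : Fin (n + 1)) : ∑ j, (chain i : Position V Q n).vec j = 1 := by
  simp [vec, sum_rowVec]

theorem sum_vec_config {q : Q} {x : V → ℕ} {t : ℕ} (hx : ∀ r, x r < 2 ^ t) :
    ∑ j, (config q x t : Position V Q n).vec j = 1 + Fintype.card V * (2 ^ t - 1) := by
  simp [vec, sum_rowVec, sum_blockVec, sum_encode hx]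

theorem two_pow_age_le [Nonempty V] (hp : p.Valid) : 2 ^ p.age ≤ 2 ^ n * ∑ j, p.vec j := by
  rcases p with i | ⟨q, x, t⟩
  · have hi : i.val ≤ n := by omega
    simpa [sum_vec_chain, age] using Nat.pow_le_pow_right two_pos hi
  · have hV : 1 ≤ Fintype.card V := Fintype.card_pos
    have ht := Nat.two_pow_pos t
    calc 2 ^ t = 1 + 1 * (2 ^ t - 1) := by omega
      _ ≤ 1 + Fintype.card V * (2 ^ t - 1) := by gcongr
      _ ≤ 2 ^ n * (1 + Fintype.card V * (2 ^ t - 1)) :=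
        Nat.le_mul_of_pos_left _ (Nat.two_pow_pos n)
      _ = 2 ^ n * ∑ j, (config q x t : Position V Q n).vec j := by
        rw [sum_vec_config hp]

theorem sum_vec_le [Nonempty V] (hp : p.Valid) :
    ∑ j, p.vec j ≤ Fintype.card V * 2 ^ p.age := by
  have hV : 1 ≤ Fintype.card V := Fintype.card_pos
  rcases p with i | ⟨q, x, t⟩
  · rw [sum_vec_chain]
    exact one_le_mul hV Nat.one_le_two_pow
  · rw [sum_vec_config hp, age]
    calc 1 + Fintype.card V * (2 ^ t - 1)
        ≤ Fintype.card V + Fintype.card V * (2 ^ t - 1) := by gcongr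
      _ = Fintype.card V * 2 ^ t := by
        rw [add_comm, ← mul_add_one, Nat.sub_add_cancel Nat.one_le_two_pow]

/-- The real row vector of the position, scaled by `c`. -/
noncomputable def scaledVec (c : ℝ) (p : Position V Q n) :
    Fin (Fintype.card (Q × Coord V) + (n + 1)) → ℝ :=
  c • fun j => (p.vec j : ℝ)

theorem sum_scaledVec (c : ℝ) : ∑ j, p.scaledVec c j = c * (∑ j, p.vec j : ℕ) := by
  simp [scaledVec, Finset.mul_sum]

theorem scaledVec_chain_one (i : Fin (n + 1)) :
    (chain i : Position V Q n).scaledVec 1 = Pi.single (chainEquiv (Q × Coord V) n (.inr i)) 1 := by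
  funext j
  obtain ⟨k | k, rfl⟩ := (chainEquiv (Q × Coord V) n).surjective j <;>
    simp [scaledVec, vec, rowVec, Pi.single_apply]

end Position

end PositionVectors

section Simulation

variable {V Q : Type*} [DecidableEq V]

/-- The matrix that carries out an assignment after Adam's choice `a`. Its column blocks are the
maps from Eve's choices to states, so that Eve's choice can be made in her own matrix. -/
def Instr.transition [DecidableEq Q] (a : Bool) :
    Instr V Q Empty → Matrix (Coord V) ((Bool → Q) × Coord V) ℕ
  | exit h => h.elim
  | le _ _ => 0
  | assign i e next => blockMatrix (next a) (stepMatrix (Function.update RegExpr.reg i e))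

/-- The linear form on `Coord V` whose value is the factor gained at a comparison. -/
def Instr.test : Instr V Q Empty → Coord V → ℕ
  | exit h => h.elim
  | le i j => Pi.single (some (i, false)) 2 + Pi.single (some (j, true)) 2
  | assign _ _ _ => 0

theorem encode_dotProduct_test_le [Fintype V] {I : Instr V Q Empty} {i j : V} (hI : I = .le i j)
    (x : V → ℕ) (t : ℕ) : encode x t ⬝ᵥ I.test = 2 * (x i + (2 ^ t - 1 - x j)) := by
  subst hI
  simp [Instr.test, encode, mul_add, mul_comm]

variable [Fintype V] [Fintype Q] [DecidableEq Q]

/-- Adam's matrices. The matrix `none` leads from everywhere to the beginning of the chain. The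
matrix `some a` executes the current instruction with Adam's choice `a`, where a comparison leads to
the beginning of the chain, and advances the chain, whose end leads to the initial configuration
`q₀`, `x₀`. -/
noncomputable def adamMatrix (S : Q → Instr V Q Empty) (q₀ : Q) (x₀ : V → ℕ) (n : ℕ) :
    Option Bool →
      Matrix (Fin (Fintype.card (Q × Coord V) + (n + 1)))
        (Fin (Fintype.card ((Bool → Q) × Coord V) + (n + 1))) ℕ
  | none => chainMatrix n 0 (fun _ => Pi.single 0 (2 ^ (n + 1))) 0
      fun _ => Pi.single 0 (2 ^ (n + 1))
  | some a => chainMatrix n (of fun p => (S p.1).transition a p.2)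
      (fun p => Pi.single 0 ((S p.1).test p.2))
      (fun i => if i = n then blockVec (fun _ => q₀) (encode x₀ (n + 1)) else 0)
      fun i => Pi.single (i + 1) 1

/-- Eve's matrix for her choice `b`. It is the identity on the chain. -/
noncomputable def eveMatrix (V Q : Type*) [DecidableEq V] [Fintype V] [Fintype Q] [DecidableEq Q]
    (n : ℕ) (b : Bool) :
    Matrix (Fin (Fintype.card ((Bool → Q) × Coord V) + (n + 1)))
      (Fin (Fintype.card (Q × Coord V) + (n + 1))) ℕ :=
  chainMatrix n (of fun p => blockMatrix (p.1 b) 1 p.2) 0 0 fun i => Pi.single i 1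

variable {S : Q → Instr V Q Empty} {q₀ : Q} {x₀ : V → ℕ} {n : ℕ}

theorem rowVec_vecMul_adamMatrix_none (u : Q × Coord V → ℕ) (c : Fin (n + 1) → ℕ) :
    rowVec u c ᵥ* adamMatrix S q₀ x₀ n none =
      rowVec 0 (Pi.single 0 (2 ^ (n + 1) * (∑ p, u p + ∑ i, c i))) := by
  rw [adamMatrix, rowVec_vecMul_chainMatrix]
  congr 1
  · ext; simp [vecMul, dotProduct]
  · refine (congrArg₂ _ (vecMul_of_single u (fun _ => _) 0) (vecMul_of_single c _ 0)).trans ?_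
    simp [← Pi.single_add, dotProduct, ← Finset.sum_mul, ← add_mul, mul_comm]

theorem blockVec_vecMul_adamMatrix_some (a : Bool) (q : Q) (v : Coord V → ℕ) :
    rowVec (n := n) (blockVec q v) 0 ᵥ* adamMatrix S q₀ x₀ n (some a) =
      rowVec (v ᵥ* (S q).transition a) (Pi.single 0 (v ⬝ᵥ (S q).test)) := by
  rw [adamMatrix, rowVec_vecMul_chainMatrix, zero_vecMul, zero_vecMul, add_zero, add_zero,
    blockVec_vecMul q v fun q => (S q).transition a]
  refine congrArg _ ((vecMul_of_single _ _ 0).trans ?_)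
  simp [dotProduct, blockVec, Fintype.sum_prod_type]

theorem chain_vecMul_adamMatrix_some (a : Bool) (i : Fin (n + 1)) :
    rowVec 0 (Pi.single i 1) ᵥ* adamMatrix S q₀ x₀ n (some a) =
      if h : i.val < n then rowVec 0 (Pi.single ⟨i + 1, by omega⟩ 1)
      else rowVec (blockVec (fun _ => q₀) (encode x₀ (n + 1))) 0 := by
  rw [adamMatrix, rowVec_vecMul_chainMatrix, single_one_vecMul, single_one_vecMul]
  split_ifs with h
  · congr 1
    · funext p
      simp [h.ne]
    · funext j
      simp only [zero_vecMul, zero_add, row, of_apply]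
      simp [Pi.single_apply, Fin.ext_iff]
  · have hi : i.val = n := by omega
    congr 1
    · simp [hi]
    · funext j
      simp [hi, j.isLt.ne]

theorem blockVec_vecMul_eveMatrix (b : Bool) (f : Bool → Q) (v : Coord V → ℕ) :
    rowVec (n := n) (blockVec f v) 0 ᵥ* eveMatrix V Q n b = rowVec (blockVec (f b) v) 0 := by
  rw [eveMatrix, rowVec_vecMul_chainMatrix,
    blockVec_vecMul f v fun f => blockMatrix (f b) 1, vecMul_blockMatrix]
  congr 1
  · simp
  · exact (congrArg₂ _ (vecMul_zero _) (zero_vecMul _)).trans (add_zero 0)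

theorem chain_vecMul_eveMatrix (b : Bool) (i : Fin (n + 1)) (g : ℕ) :
    rowVec 0 (Pi.single i g) ᵥ* eveMatrix V Q n b = g • rowVec 0 (Pi.single i 1) := by
  rw [eveMatrix, rowVec_vecMul_chainMatrix, smul_rowVec]
  congr 1
  · exact (congrArg₂ _ (zero_vecMul _) (vecMul_zero _)).trans (by simp)
  · funext j
    simp [Pi.single_apply, Fin.ext_iff]

namespace Position

variable {p : Position V Q n}

theorem vec_vecMul_some (hp : p.Valid) (a b : Bool) :
    p.vec ᵥ* adamMatrix S q₀ x₀ n (some a) ᵥ* eveMatrix V Q n b =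
      p.gain S • (p.next S q₀ x₀ a b).vec := by
  rcases p with i | ⟨q, x, t⟩
  · simp only [vec, chain_vecMul_adamMatrix_some, gain, next, one_smul]
    split_ifs
    · rw [chain_vecMul_eveMatrix, one_smul]
    · exact blockVec_vecMul_eveMatrix ..
  · simp only [vec, blockVec_vecMul_adamMatrix_some, gain, next]
    rcases S q with h | ⟨i, j⟩ | ⟨i, e, next⟩
    · exact h.elim
    · rw [encode_dotProduct_test_le rfl, Instr.transition, vecMul_zero, chain_vecMul_eveMatrix]
    · rw [Instr.test, dotProduct_zero, Pi.single_zero, Instr.transition, vecMul_blockMatrix,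
        encode_vecMul_stepMatrix _ hp, eval_update_reg, blockVec_vecMul_eveMatrix, one_smul]

theorem vecMul_none (w : Fin (Fintype.card (Q × Coord V) + (n + 1)) → ℕ) (b : Bool) :
    w ᵥ* adamMatrix S q₀ x₀ n none ᵥ* eveMatrix V Q n b =
      (2 ^ (n + 1) * ∑ j, w j) • (chain 0 : Position V Q n).vec := by
  obtain ⟨u, c, rfl⟩ := exists_eq_rowVec w
  rw [rowVec_vecMul_adamMatrix_none, chain_vecMul_eveMatrix, sum_rowVec, vec]

end Position

end Simulation

section Value

variable {V Q : Type*} [DecidableEq V] [Fintype V] [Fintype Q] [DecidableEq Q]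
  {S : Q → Instr V Q Empty} {q₀ : Q} {x₀ : V → ℕ} {n : ℕ}

/-- The matrix multiplication game that simulates the system `S`, started in state `q₀` with
register contents `x₀`. -/
noncomputable def systemGame (S : Q → Instr V Q Empty) (q₀ : Q) (x₀ : V → ℕ) (n : ℕ) : NatGame where
  m := Fintype.card (Q × Coord V) + (n + 1)
  n := Fintype.card ((Bool → Q) × Coord V) + (n + 1)
  m_pos := Nat.succ_pos _
  n_pos := Nat.succ_pos _
  adam := Finset.univ.image (adamMatrix S q₀ x₀ n)
  eve := Finset.univ.image (eveMatrix V Q n)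
  adam_nonempty := Finset.univ_nonempty.image _
  eve_nonempty := Finset.univ_nonempty.image _

theorem mem_adamSet_systemGame (a : Option Bool) :
    (adamMatrix S q₀ x₀ n a).map (↑) ∈ (systemGame S q₀ x₀ n).adamSet :=
  ⟨_, Finset.mem_image_of_mem _ (Finset.mem_univ a), rfl⟩

theorem forall_mem_adamSet_systemGame {P : Matrix _ _ ℝ → Prop}
    (h : ∀ a, P ((adamMatrix S q₀ x₀ n a).map (↑))) :
    ∀ A ∈ (systemGame S q₀ x₀ n).adamSet, P A := by
  rintro _ ⟨_, hB, rfl⟩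
  obtain ⟨a, -, rfl⟩ := Finset.mem_image.1 hB
  exact h a

theorem mem_eveSet_systemGame (b : Bool) :
    (eveMatrix V Q n b).map (↑) ∈ (systemGame S q₀ x₀ n).eveSet :=
  ⟨_, Finset.mem_image_of_mem _ (Finset.mem_univ b), rfl⟩

theorem forall_mem_eveSet_systemGame {P : Matrix _ _ ℝ → Prop}
    (h : ∀ b, P ((eveMatrix V Q n b).map (↑))) :
    ∀ E ∈ (systemGame S q₀ x₀ n).eveSet, P E := by
  rintro _ ⟨_, hB, rfl⟩
  obtain ⟨b, -, rfl⟩ := Finset.mem_image.1 hB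
  exact h b

theorem smul_cast_vecMul_vecMul {ι κ : Type*} [Fintype ι] [Fintype κ] (c : ℝ) (w : ι → ℕ)
    (A : Matrix ι κ ℕ) (E : Matrix κ ι ℕ) :
    (c • fun j => (w j : ℝ)) ᵥ* A.map (↑) ᵥ* E.map (↑) =
      c • fun j => ((w ᵥ* A ᵥ* E) j : ℝ) := by
  rw [smul_vecMul, smul_vecMul]
  congr 1
  funext j
  simp [vecMul, dotProduct]

namespace Position

variable {p : Position V Q n}

theorem inv_smul_scaledVec_vecMul_some (r c : ℝ) (hp : p.Valid) (a b : Bool) :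
    r⁻¹ • (p.scaledVec c ᵥ* (adamMatrix S q₀ x₀ n (some a)).map (↑) ᵥ*
      (eveMatrix V Q n b).map (↑)) =
      (p.next S q₀ x₀ a b).scaledVec (r⁻¹ * (c * p.gain S)) := by
  rw [scaledVec, smul_cast_vecMul_vecMul, vec_vecMul_some hp, scaledVec]
  funext j
  simp [mul_assoc]

theorem inv_smul_cast_vecMul_none (r c : ℝ) (w : Fin (Fintype.card (Q × Coord V) + (n + 1)) → ℕ)
    (b : Bool) :
    r⁻¹ • ((c • fun j => (w j : ℝ)) ᵥ* (adamMatrix S q₀ x₀ n none).map (↑) ᵥ*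
      (eveMatrix V Q n b).map (↑)) =
      (chain 0 : Position V Q n).scaledVec (r⁻¹ * (c * (2 ^ (n + 1) * (∑ j, w j : ℕ)))) := by
  rw [smul_cast_vecMul_vecMul, vecMul_none, scaledVec]
  funext j
  simp [mul_assoc]

theorem inv_smul_one_vecMul_none (r : ℝ) (b : Bool) :
    r⁻¹ • (1 ᵥ* (adamMatrix S q₀ x₀ n none).map (↑) ᵥ* (eveMatrix V Q n b).map (↑)) =
      (chain 0 : Position V Q n).scaledVec
        (r⁻¹ * (2 ^ (n + 1) * (Fintype.card (Q × Coord V) + (n + 1) : ℕ))) := by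
  have hone : (1 : Fin (Fintype.card (Q × Coord V) + (n + 1)) → ℝ) =
      (1 : ℝ) • fun _ => ((1 : ℕ) : ℝ) := by
    simp [Pi.one_def]
  rw [hone, inv_smul_cast_vecMul_none, one_mul]
  simp

end Position

open Position

theorem exists_rate_lt_two (T : ℕ) :
    ∃ r : ℝ, 1 ≤ r ∧ r < 2 ∧ ∀ t ≤ T, 2 * (2 ^ t - 1) ≤ r ^ (t + 1) := by
  have hlt (t : ℕ) : ∀ᶠ r in nhds (2 : ℝ), 2 * (2 ^ t - 1) < r ^ (t + 1) :=
    ((continuous_pow (t + 1)).tendsto 2).eventually (lt_mem_nhds (by rw [pow_succ']; linarith))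
  have hall := (Filter.eventually_all_finset (Finset.range (T + 1))).2 fun t _ => hlt t
  obtain ⟨r, hr, hr1, hr2⟩ := ((hall.filter_mono nhdsWithin_le_nhds).and
    (Ioo_mem_nhdsLT one_lt_two)).exists
  exact ⟨r, hr1.le, hr2, fun t ht => (hr t (Finset.mem_range_succ_iff.2 ht)).le⟩

theorem two_le_maxEvePayoff [Nonempty V] (hx₀ : ∀ r, x₀ r < 2 ^ (n + 1))
    (hF : ¬ Forces S Empty.elim q₀ x₀) : 2 ≤ (systemGame S q₀ x₀ n).maxEvePayoff := by
  rw [← ENNReal.ofReal_ofNat]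
  refine le_sSup (eveEnsures_of_invariant (s := chainEquiv (Q × Coord V) n (.inr 0))
    (ε := (2 ^ n)⁻¹) (K := {y | ∃ (c : ℝ) (p : Position V Q n),
      y = p.scaledVec c ∧ p.Valid ∧ p.Safe S ∧ 0 ≤ c ∧ 1 ≤ c * 2 ^ p.age})
    two_pos (by positivity) ?_ ?_ ?_)
  · exact ⟨1, .chain 0, (scaledVec_chain_one 0).symm, trivial, trivial, zero_le_one, by simp [age]⟩
  · rintro _ ⟨c, p, rfl, hp, hs, hc, hcp⟩
    refine forall_mem_adamSet_systemGame fun a => ?_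
    rcases a with _ | a
    · refine ⟨_, mem_eveSet_systemGame true, _, .chain 0,
        inv_smul_cast_vecMul_none 2 c p.vec true, trivial, trivial, by positivity, ?_⟩
      calc 1 ≤ c * 2 ^ p.age := hcp
        _ ≤ c * (2 ^ n * (∑ j, p.vec j : ℕ)) := by gcongr; exact_mod_cast two_pow_age_le hp
        _ = _ := by simp only [age, Fin.val_zero]; ring
    · obtain ⟨b, hb, hgain⟩ := exists_safe_next hF hp hs a
      refine ⟨_, mem_eveSet_systemGame b, _, _, inv_smul_scaledVec_vecMul_some 2 c hp a b,
        hp.next hx₀ a b, hb, by positivity, ?_⟩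
      calc 1 ≤ c * 2 ^ p.age := hcp
        _ = 2⁻¹ * (c * (2 * 2 ^ p.age)) := by ring
        _ ≤ 2⁻¹ * (c * (p.gain S * 2 ^ (p.next S q₀ x₀ a b).age)) := by
          gcongr 2⁻¹ * (c * ?_); exact_mod_cast hgain
        _ = _ := by ring
  · rintro _ ⟨c, p, rfl, hp, -, hc, hcp⟩
    rw [sum_scaledVec, inv_le_iff_one_le_mul₀ (by positivity)]
    calc 1 ≤ c * 2 ^ p.age := hcp
      _ ≤ c * (2 ^ n * (∑ j, p.vec j : ℕ)) := by gcongr; exact_mod_cast two_pow_age_le hp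
      _ = _ := by ring

theorem maxEvePayoff_le_of_forcesIn [Nonempty V] {h₀ T : ℕ} {r : ℝ}
    (hx₀ : ∀ r, x₀ r < 2 ^ (n + 1)) (hF : ForcesIn S Empty.elim h₀ q₀ x₀) (hT : h₀ + (n + 1) ≤ T)
    (hr1 : 1 ≤ r) (hr : ∀ t ≤ T, 2 * (2 ^ t - 1) ≤ r ^ (t + 1)) :
    (systemGame S q₀ x₀ n).maxEvePayoff ≤ ENNReal.ofReal r := by
  let m : ℕ := Fintype.card (Q × Coord V) + (n + 1)
  let B : ℝ := 2 ^ (n + 1) * m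
  refine eveValue_le_of_invariant (C := m + B * (Fintype.card V * 2 ^ T))
    (K := insert 1 {y | ∃ (c : ℝ) (p : Position V Q n),
      y = p.scaledVec c ∧ p.Valid ∧ p.WonBy S T ∧ 0 ≤ c ∧ c * r ^ p.age ≤ B})
    (forall_mem_adamSet_systemGame fun a i j => Nat.cast_nonneg _)
    (forall_mem_eveSet_systemGame fun b i j => Nat.cast_nonneg _)
    (by positivity) (by positivity) (Set.mem_insert _ _) ?_ ?_
  · rintro _ (rfl | ⟨c, p, rfl, hp, hw, hc, hcp⟩)
    · refine ⟨_, mem_adamSet_systemGame none, forall_mem_eveSet_systemGame fun b => .inr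
        ⟨_, .chain 0, inv_smul_one_vecMul_none r b, trivial, trivial, by positivity, ?_⟩⟩
      rw [age, Fin.val_zero, pow_zero, mul_one]
      exact mul_le_of_le_one_left (by positivity) (inv_le_one_of_one_le₀ hr1)
    · obtain ⟨a, ha⟩ := exists_wonBy_next hF hT hr hp hw
      refine ⟨_, mem_adamSet_systemGame (some a), forall_mem_eveSet_systemGame fun b => .inr
        ⟨_, _, inv_smul_scaledVec_vecMul_some r c hp a b, hp.next hx₀ a b, (ha b).1,
          by positivity, ?_⟩⟩
      calc r⁻¹ * (c * p.gain S) * r ^ (p.next S q₀ x₀ a b).age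
        _ = r⁻¹ * (c * (p.gain S * r ^ (p.next S q₀ x₀ a b).age)) := by ring
        _ ≤ r⁻¹ * (c * r ^ (p.age + 1)) := by gcongr r⁻¹ * (c * ?_); exact (ha b).2
        _ = c * r ^ p.age := by rw [pow_succ]; field_simp
        _ ≤ B := hcp
  · rintro _ (rfl | ⟨c, p, rfl, hp, hw, hc, hcp⟩)
    · have hone : ∑ _j : Fin m, (1 : ℝ) = m := by simp
      exact hone.trans_le (le_add_of_nonneg_right (by positivity))
    · have hage : p.age ≤ T := hw.age_le (by omega)
      have hcB : c ≤ B := (le_mul_of_one_le_right hc (one_le_pow₀ hr1)).trans hcp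
      have hsum : ∑ j, p.vec j ≤ Fintype.card V * 2 ^ T :=
        (sum_vec_le hp).trans (by gcongr; exact one_le_two)
      calc ∑ j, p.scaledVec c j = c * (∑ j, p.vec j : ℕ) := sum_scaledVec c
        _ ≤ B * (Fintype.card V * 2 ^ T) := by gcongr; exact_mod_cast hsum
        _ ≤ m + B * (Fintype.card V * 2 ^ T) := le_add_of_nonneg_left (by positivity)

theorem maxEvePayoff_lt_two_iff [Nonempty V] (hx₀ : ∀ r, x₀ r < 2 ^ (n + 1)) :
    (systemGame S q₀ x₀ n).maxEvePayoff < 2 ↔ Forces S Empty.elim q₀ x₀ := by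
  refine ⟨fun h => by_contra fun hF => (two_le_maxEvePayoff hx₀ hF).not_gt h, fun ⟨h₀, hF⟩ => ?_⟩
  obtain ⟨r, hr1, hr2, hr⟩ := exists_rate_lt_two (h₀ + (n + 1))
  refine (maxEvePayoff_le_of_forcesIn hx₀ hF le_rfl hr1 hr).trans_lt ?_
  rw [← ENNReal.ofReal_ofNat]
  exact (ENNReal.ofReal_lt_ofReal_iff two_pos).2 hr2

end Value

/-! ### Computability of the reduction -/

theorem matrixCode_injective {m n : ℕ} :
    Function.Injective (matrixCode : Matrix (Fin m) (Fin n) ℕ → List (List ℕ)) := by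
  intro A B h
  funext i j
  exact congrFun (List.ofFn_injective (congrFun (List.ofFn_injective h) i)) j

theorem IsCodeOf.unique {c : GameCode} {G G' : NatGame} (h : IsCodeOf c G) (h' : IsCodeOf c G') :
    G = G' := by
  obtain ⟨As, Es, hA, hE, rfl⟩ := h
  obtain ⟨As', Es', hA', hE', hc⟩ := h'
  obtain ⟨m, n, hm, hn, adam, eve, hadam, heve⟩ := G
  obtain ⟨m', n', hm', hn', adam', eve', hadam', heve'⟩ := G'
  simp only [Prod.mk.injEq] at hc
  obtain ⟨rfl, rfl, hAs, hEs⟩ := hc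
  obtain rfl := List.map_injective_iff.2 matrixCode_injective hAs
  obtain rfl := List.map_injective_iff.2 matrixCode_injective hEs
  obtain rfl : adam = adam' := Finset.ext fun B => (hA B).symm.trans (hA' B)
  obtain rfl : eve = eve' := Finset.ext fun B => (hE B).symm.trans (hE' B)
  rfl

theorem ofFn_val_eq_map_range {α : Type*} (k : ℕ) (g : ℕ → α) :
    (List.ofFn fun j : Fin k => g j) = (List.range k).map g := by
  apply List.ext_getElem <;> simp

section ChainCode

variable {α β : Type*} [Fintype α] [Fintype β]

theorem ofFn_comp_chainEquiv_symm {γ : Type*} (n : ℕ) (f : α ⊕ Fin (n + 1) → γ) :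
    (List.ofFn fun j => f ((chainEquiv α n).symm j)) =
      (List.ofFn fun j => f (.inl ((Fintype.equivFin α).symm j))) ++
        List.ofFn fun j => f (.inr j) := by
  have hl (j : Fin (Fintype.card α)) :
      (chainEquiv α n).symm (Fin.castAdd (n + 1) j) = .inl ((Fintype.equivFin α).symm j) := by
    simp [chainEquiv]
  have hr (j : Fin (n + 1)) : (chainEquiv α n).symm (Fin.natAdd _ j) = .inr j := by
    simp [chainEquiv]
  simp only [← hl, ← hr]
  exact List.ofFn_add

theorem matrixCode_chainMatrix (n : ℕ) (A : Matrix α β ℕ) (B : α → ℕ → ℕ) (C : ℕ → β → ℕ)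
    (D : ℕ → ℕ → ℕ) : matrixCode (chainMatrix n A B C D) =
      (List.ofFn fun i =>
        (List.ofFn fun j => A ((Fintype.equivFin α).symm i) ((Fintype.equivFin β).symm j)) ++
          (List.range (n + 1)).map (B ((Fintype.equivFin α).symm i))) ++
      (List.range (n + 1)).map fun i =>
        (List.ofFn fun j => C i ((Fintype.equivFin β).symm j)) ++
          (List.range (n + 1)).map (D i) := by
  simp only [← ofFn_val_eq_map_range]
  let N : Matrix (α ⊕ Fin (n + 1)) (β ⊕ Fin (n + 1)) ℕ :=
    fromBlocks A (of fun a j => B a j) (of fun i b => C i b) (of fun i j => D i j)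
  refine (ofFn_comp_chainEquiv_symm n fun i => List.ofFn fun j =>
    N i ((chainEquiv β n).symm j)).trans ?_
  simp only [ofFn_comp_chainEquiv_symm n (N _)]
  rfl

theorem primrec_matrixCode_chainMatrix {A : ℕ → Matrix α β ℕ} {B : ℕ → α → ℕ → ℕ}
    {C : ℕ → ℕ → β → ℕ} {D : ℕ → ℕ → ℕ → ℕ} (hA : ∀ a b, Primrec fun n => A n a b)
    (hB : ∀ a, Primrec₂ fun n j => B n a j) (hC : ∀ b, Primrec₂ fun n i => C n i b)
    (hD : Primrec₂ fun (p : ℕ × ℕ) j => D p.1 p.2 j) :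
    Primrec fun n => matrixCode (chainMatrix n (A n) (B n) (C n) (D n)) := by
  simp only [matrixCode_chainMatrix]
  have hrange : Primrec fun n => List.range (n + 1) := Primrec.list_range.comp Primrec.succ
  refine Primrec.list_append.comp (Primrec.list_ofFn fun i => ?_) (Primrec.list_map hrange ?_)
  · exact Primrec.list_append.comp (Primrec.list_ofFn fun j => hA _ _)
      (Primrec.list_map hrange (hB _))
  · exact Primrec.list_append.comp (Primrec.list_ofFn fun j => hC _)
      (Primrec.list_map (hrange.comp Primrec.fst) hD)

end ChainCode

theorem primrec₂_single {α : Type*} [Primcodable α] {f g : α → ℕ} (hf : Primrec f)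
    (hg : Primrec g) : Primrec₂ fun x j => (Pi.single (f x) (g x) : ℕ → ℕ) j := by
  simp only [Pi.single_apply]
  exact Primrec.ite (Primrec.eq.comp Primrec.snd (hf.comp Primrec.fst)) (hg.comp Primrec.fst)
    (Primrec.const 0)

theorem primrec_two_pow_succ : Primrec fun n : ℕ => 2 ^ (n + 1) :=
  (Primrec₂.unpaired'.1 Nat.Primrec.pow).comp (Primrec.const 2) Primrec.succ

theorem primrec_blockVec {σ κ : Type*} [DecidableEq σ] {v : ℕ → κ → ℕ}
    (hv : ∀ k, Primrec fun n => v n k) (s : σ) (p : σ × κ) :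
    Primrec fun n => blockVec s (v n) p := by
  by_cases hp : p.1 = s <;> simp only [blockVec, hp, if_true, if_false]
  · exact hv p.2
  · exact Primrec.const 0

theorem primrec_encode {V : Type*} {x₀ : ℕ → V → ℕ} (hx₀ : ∀ r, Primrec fun n => x₀ n r)
    (κ : Coord V) : Primrec fun n => encode (x₀ n) (n + 1) κ := by
  match κ with
  | none => exact Primrec.const 1
  | some (r, false) => exact hx₀ r
  | some (r, true) =>
    exact Primrec.nat_sub.comp (Primrec.nat_sub.comp primrec_two_pow_succ (Primrec.const 1))
      (hx₀ r)

section SystemCode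

variable {V Q : Type*} [Fintype V] [DecidableEq V] [Fintype Q] [DecidableEq Q]

theorem primrec_matrixCode_adamMatrix (S : Q → Instr V Q Empty) (q₀ : Q) {x₀ : ℕ → V → ℕ}
    (hx₀ : ∀ r, Primrec fun n => x₀ n r) (a : Option Bool) :
    Primrec fun n => matrixCode (adamMatrix S q₀ (x₀ n) n a) := by
  rcases a with _ | a <;> simp only [adamMatrix]
  · refine primrec_matrixCode_chainMatrix (fun _ _ => Primrec.const 0) (fun _ => ?_)
      (fun _ => Primrec.const 0) ?_
    · exact primrec₂_single (Primrec.const 0) primrec_two_pow_succ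
    · exact primrec₂_single (Primrec.const 0) (primrec_two_pow_succ.comp Primrec.fst)
  · refine primrec_matrixCode_chainMatrix (fun _ _ => Primrec.const _) (fun _ => ?_)
      (fun p => ?_) ?_
    · exact primrec₂_single (Primrec.const 0) (Primrec.const _)
    · simp only [ite_apply, Pi.zero_apply]
      exact Primrec.ite (Primrec.eq.comp Primrec.snd Primrec.fst)
        ((primrec_blockVec (primrec_encode hx₀) _ p).comp Primrec.fst) (Primrec.const 0)
    · exact primrec₂_single (Primrec.succ.comp Primrec.snd) (Primrec.const 1)

theorem primrec_matrixCode_eveMatrix (b : Bool) :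
    Primrec fun n => matrixCode (eveMatrix V Q n b) :=
  primrec_matrixCode_chainMatrix (fun _ _ => Primrec.const _) (fun _ => Primrec.const 0)
    (fun _ => Primrec.const 0) (primrec₂_single Primrec.snd (Primrec.const 1))

/-- A description of the game of a system, for the `n`-th register contents `x₀ n`. -/
noncomputable def systemCode (S : Q → Instr V Q Empty) (q₀ : Q) (x₀ : ℕ → V → ℕ) (n : ℕ) :
    GameCode :=
  ((systemGame S q₀ (x₀ n) n).m, (systemGame S q₀ (x₀ n) n).n,
    [none, some true, some false].map fun a => matrixCode (adamMatrix S q₀ (x₀ n) n a),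
    [true, false].map fun b => matrixCode (eveMatrix V Q n b))

theorem isCodeOf_systemCode (S : Q → Instr V Q Empty) (q₀ : Q) (x₀ : ℕ → V → ℕ) (n : ℕ) :
    IsCodeOf (systemCode S q₀ x₀ n) (systemGame S q₀ (x₀ n) n) := by
  have hA (B) : B ∈ [none, some true, some false].map (adamMatrix S q₀ (x₀ n) n) ↔
      B ∈ Finset.univ.image (adamMatrix S q₀ (x₀ n) n) := by
    simp [Option.exists, or_comm, eq_comm]
  have hE (B) : B ∈ [true, false].map (eveMatrix V Q n) ↔
      B ∈ Finset.univ.image (eveMatrix V Q n) := by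
    simp [or_comm]
  exact ⟨_, _, hA, hE, rfl⟩

theorem primrec_systemCode (S : Q → Instr V Q Empty) (q₀ : Q) {x₀ : ℕ → V → ℕ}
    (hx₀ : ∀ r, Primrec fun n => x₀ n r) : Primrec (systemCode S q₀ x₀) := by
  have hdim (d : ℕ) : Primrec fun n => d + (n + 1) :=
    Primrec.nat_add.comp (Primrec.const d) Primrec.succ
  have hA := primrec_matrixCode_adamMatrix S q₀ hx₀
  have hE := primrec_matrixCode_eveMatrix (V := V) (Q := Q)
  refine (hdim _).pair ((hdim _).pair (.pair ?_ ?_))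
  · exact Primrec.list_cons.comp (hA none) (Primrec.list_cons.comp (hA (some true))
      (Primrec.list_cons.comp (hA (some false)) (Primrec.const [])))
  · exact Primrec.list_cons.comp (hE true) (Primrec.list_cons.comp (hE false) (Primrec.const []))

end SystemCode

theorem primrec_single {ι : Type*} [DecidableEq ι] (i r : ι) :
    Primrec fun n : ℕ => (Pi.single i n : ι → ℕ) r := by
  by_cases hr : r = i <;> simp only [Pi.single_apply, hr, if_true, if_false]
  · exact Primrec.id
  · exact Primrec.const 0

theorem single_lt_two_pow_succ {ι : Type*} [DecidableEq ι] (i r : ι) (n : ℕ) :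
    (Pi.single i n : ι → ℕ) r < 2 ^ (n + 1) := by
  have hn : n < 2 ^ (n + 1) := n.lt_succ_self.trans Nat.lt_two_pow_self
  rw [Pi.single_apply]
  split_ifs <;> omega

end MMG

theorem mainTheorem8 :
    ¬ ComputablePred fun c : MMG.GameCode =>
      ∃ G : MMG.NatGame, MMG.IsCodeOf c G ∧ G.maxEvePayoff < 2 := by
  classical
  intro hc
  obtain ⟨R, Q, hQ, S, q₀, hS⟩ := MMG.exists_undecidable_system
  have := Fintype.ofFinite Q
  have hcomp := MMG.primrec_systemCode S q₀ (MMG.primrec_single 0)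
  refine hS ((MMG.computablePred_comp hc hcomp.to_comp).of_eq fun n => ?_)
  have hcode := MMG.isCodeOf_systemCode S q₀ (fun n => Pi.single 0 n) n
  rw [← MMG.maxEvePayoff_lt_two_iff fun r => MMG.single_lt_two_pow_succ 0 r n]
  exact ⟨fun ⟨G, hG, hlt⟩ => hG.unique hcode ▸ hlt, fun hlt => ⟨_, hcode, hlt⟩⟩
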